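/- For $\lambda\in\mathbb R$ put $e_\lambda(t)=e^{2\pi i\lambda t}$. A system of vectors in a Hilbert space is called a Riesz basis if it is the image of an orthonormal basis under a bounded invertible operator. Let $S\subseteq[0,1]$ be a union of $L$ intervals, let $N$ be a positive integer, and let $m\ge 0$ be the integer with $\frac mN\le |S|<\frac{m+1}N$, where $|S|$ is the Lebesgue measure of $S$. Then there exists a set $\Lambda\subseteq\mathbb Z$ such that the system $\{e_\lambda\}_{\lambda\in\Lambda}$ is a Riesz basis of $L^2(S)$ and $$\bigcup_{j=0}^{m-2L-1}(N\mathbb Z+j)\;\subseteq\;\Lambda\;\subseteq\;\bigcup_{j=0}^{m+2L}(N\mathbb Z+j),$$ where the union on the left is empty if $m-2L-1<0$. -/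

import Mathlib

open MeasureTheory

/-- A system of vectors in a Hilbert space is a *Riesz basis* if it is the image of an orthonormal
basis under a bounded invertible operator. -/
def IsRieszBasis {ι H : Type*} [NormedAddCommGroup H] [InnerProductSpace ℂ H]
    (f : ι → H) : Prop :=
  ∃ (b : HilbertBasis ι ℂ H) (T : H ≃L[ℂ] H), ∀ i, f i = T (b i)

/-- The exponential `e_l(t) = exp(2 π i l t)` of real frequency `l`. -/
noncomputable def expFun (l : ℝ) (t : ℝ) : ℂ :=
  Complex.exp (2 * Real.pi * Complex.I * l * t)

/-- The exponentials `e_l`, `l ∈ Λ`, belong to `L²(S)` and form a Riesz basis of `L²(S)`. The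
family `f` consists of the classes of the functions `e_l` in `L²(S)`, so it is unique. -/
def IsExpRieszBasis (S Λ : Set ℝ) : Prop :=
  ∃ f : Λ → Lp ℂ 2 (volume.restrict S),
    (∀ l : Λ, f l =ᵐ[volume.restrict S] expFun (l : ℝ)) ∧ IsRieszBasis f

/-- The arithmetic progression `Nℤ + j`, as a set of real numbers. -/
def progression (N : ℕ) (j : ℤ) : Set ℝ :=
  {x | ∃ k : ℤ, x = (N : ℝ) * k + j}

/-!
Fold `S` by `t ↦ N * t`, and let `S_n` be the set of points of the circle with more than `n`
preimages in `S`. If for each `n < N` the integers `Λ_n` are the frequencies of a Riesz basis over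
`S_n`, then the union of the `N * Λ_n + n` serves for `S`: over a point with `k` preimages only the
components `0, …, k - 1` matter, and they are recovered from the `k` values by inverting a
Vandermonde matrix. The number of preimages has mean `N * |S|` and varies by at most the number of
intervals, hence `S_n` is conull for small `n` and null for large `n`.

It remains to find a Riesz basis of integer exponentials over every finite union of arcs, by
induction on the number of endpoints, using folding again. If two endpoints differ by a rational
number, folding by its denominator makes them coincide. If all the differences are irrational, then
a suitable folding leaves every level set with fewer endpoints: otherwise the jumps of the folded
multiplicity would be those of an indicator function, and by recurrence of the irrational rotations
`N` can be chosen so that its first Fourier coefficients are too large. What remains is a single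
arc, which irrational folding makes short, and there rounded multiples of the reciprocal of its
length work because small perturbations of an orthonormal exponential basis remain Riesz bases.
-/

open Filter Topology

theorem expFun_eq (l t : ℝ) :
    expFun l t = Complex.exp (((2 * Real.pi * (l * t) : ℝ) : ℂ) * Complex.I) := by
  unfold expFun; congr 1; push_cast; ring

theorem norm_expFun (l t : ℝ) : ‖expFun l t‖ = 1 := by
  rw [expFun_eq, Complex.norm_exp_ofReal_mul_I]

theorem expFun_ne_zero (l t : ℝ) : expFun l t ≠ 0 := Complex.exp_ne_zero _

theorem expFun_add_left (a b t : ℝ) : expFun (a + b) t = expFun a t * expFun b t := by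
  unfold expFun; rw [← Complex.exp_add]; congr 1; push_cast; ring

theorem expFun_add_right (a s t : ℝ) : expFun a (s + t) = expFun a s * expFun a t := by
  unfold expFun; rw [← Complex.exp_add]; congr 1; push_cast; ring

theorem expFun_congr {a s b t : ℝ} (h : a * s = b * t) : expFun a s = expFun b t := by
  rw [expFun_eq, expFun_eq, h]

theorem expFun_zero_left (t : ℝ) : expFun 0 t = 1 := by simp [expFun]

theorem expFun_zero_right (l : ℝ) : expFun l 0 = 1 := by simp [expFun]

theorem conj_expFun (l t : ℝ) : (starRingEnd ℂ) (expFun l t) = expFun (-l) t := by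
  rw [expFun_eq, expFun_eq, ← Complex.exp_conj]
  congr 1
  simp only [map_mul, Complex.conj_ofReal, Complex.conj_I]
  push_cast; ring

theorem expFun_eq_one_iff (l t : ℝ) : expFun l t = 1 ↔ ∃ n : ℤ, l * t = n := by
  have hpi : (2 * Real.pi * Complex.I : ℂ) ≠ 0 := by simp [Real.pi_ne_zero]
  rw [expFun, Complex.exp_eq_one_iff]
  refine exists_congr fun n => ?_
  rw [mul_comm (n : ℂ), mul_assoc _ (l : ℂ), mul_right_inj' hpi]
  norm_cast

theorem expFun_int_int (k n : ℤ) : expFun k n = 1 :=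
  (expFun_eq_one_iff _ _).2 ⟨k * n, by push_cast; rfl⟩

theorem expFun_pow (l t : ℝ) (n : ℕ) : expFun l t ^ n = expFun (n * l) t := by
  unfold expFun; rw [← Complex.exp_nat_mul]; congr 1; push_cast; ring

@[fun_prop]
theorem continuous_expFun (l : ℝ) : Continuous (expFun l) := by
  unfold expFun; fun_prop

/-- Lebesgue measure on the unit interval. It is carried by `Ioc 0 1` rather than `Icc 0 1` so that
it is the pushforward of Haar measure under a bijection from the circle. -/
noncomputable abbrev unitVol : Measure ℝ := volume.restrict (Set.Ioc (0 : ℝ) 1)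

instance isProbabilityMeasure_unitVol : IsProbabilityMeasure unitVol := ⟨by simp⟩

theorem volume_eq_haarAddCircle :
    (volume : Measure (AddCircle (1 : ℝ))) = AddCircle.haarAddCircle := by
  rw [AddCircle.volume_eq_smul_haarAddCircle, ENNReal.ofReal_one, one_smul]

theorem measurePreserving_unitVol_circle :
    MeasurePreserving ((↑) : ℝ → AddCircle (1 : ℝ)) unitVol AddCircle.haarAddCircle := by
  simpa only [volume_eq_haarAddCircle, zero_add] using AddCircle.measurePreserving_mk (1 : ℝ) 0

theorem measurePreserving_circle_unitVol :
    MeasurePreserving (fun z => (AddCircle.equivIoc (1 : ℝ) 0 z : ℝ))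
      AddCircle.haarAddCircle unitVol := by
  have hIoc : unitVol = volume.restrict (Set.Ioc (0 : ℝ) (0 + 1)) := by rw [zero_add]
  rw [← volume_eq_haarAddCircle, hIoc]
  exact (measurePreserving_subtype_coe measurableSet_Ioc).comp
    (AddCircle.measurePreserving_equivIoc (T := 1) (a := 0))

theorem equivIoc_coe_ae_eq :
    (fun t : ℝ => (AddCircle.equivIoc (1 : ℝ) 0 (t : AddCircle (1 : ℝ)) : ℝ)) =ᵐ[unitVol] id := by
  filter_upwards [ae_restrict_mem measurableSet_Ioc] with t ht
  have ht' : t ∈ Set.Ioc (0 : ℝ) (0 + 1) := by rwa [zero_add]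
  exact congrArg Subtype.val (AddCircle.equivIoc_coe_eq ht')

/-- The isometry of `L²` of the circle onto `L²` of the unit interval, given by composition with the
quotient map. -/
noncomputable def circleEquiv :
    Lp ℂ 2 (AddCircle.haarAddCircle (T := (1 : ℝ))) ≃ₗᵢ[ℂ] Lp ℂ 2 unitVol :=
  LinearIsometryEquiv.ofSurjective
    (Lp.compMeasurePreservingₗᵢ ℂ _ measurePreserving_unitVol_circle) fun g => by
      refine ⟨Lp.compMeasurePreserving _ measurePreserving_circle_unitVol g, Lp.ext ?_⟩
      refine (Lp.coeFn_compMeasurePreserving _ measurePreserving_unitVol_circle).trans ?_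
      refine (measurePreserving_unitVol_circle.quasiMeasurePreserving.ae_eq_comp
        (Lp.coeFn_compMeasurePreserving g measurePreserving_circle_unitVol)).trans ?_
      filter_upwards [equivIoc_coe_ae_eq] with t ht
      exact congrArg g ht

/-- The orthonormal basis of `L²` of the unit interval formed by the exponentials of integer
frequency. -/
noncomputable def expBasis : HilbertBasis ℤ ℂ (Lp ℂ 2 unitVol) :=
  HilbertBasis.ofRepr (circleEquiv.symm.trans fourierBasis.repr)

theorem coeFn_expBasis (k : ℤ) : expBasis k =ᵐ[unitVol] expFun k := by
  have h : expBasis k = circleEquiv (fourierBasis k) := by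
    simp [expBasis, ← HilbertBasis.repr_symm_single]
  rw [h, coe_fourierBasis]
  refine (Lp.coeFn_compMeasurePreserving _ measurePreserving_unitVol_circle).trans ?_
  refine (measurePreserving_unitVol_circle.quasiMeasurePreserving.ae_eq_comp
    (coeFn_fourierLp 2 k)).trans (Eventually.of_forall fun t => ?_)
  simp only [Function.comp_apply, fourier_coe_apply, expFun]
  congr 1; push_cast; ring

/-- The Fourier coefficient of a function on the unit interval. -/
noncomputable def fcoeff (g : ℝ → ℂ) (k : ℤ) : ℂ := ∫ t, expFun (-k) t * g t ∂unitVol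

theorem fcoeff_congr {f g : ℝ → ℂ} (h : f =ᵐ[unitVol] g) (k : ℤ) : fcoeff f k = fcoeff g k :=
  integral_congr_ae (h.mono fun t ht => by simp only [ht])

theorem expBasis_repr (g : Lp ℂ 2 unitVol) (k : ℤ) : expBasis.repr g k = fcoeff g k := by
  rw [HilbertBasis.repr_apply_apply, L2.inner_def]
  refine integral_congr_ae ?_
  filter_upwards [coeFn_expBasis k] with t ht
  rw [ht, RCLike.inner_apply, conj_expFun, mul_comm]

theorem expBasis_repr_toLp {g : ℝ → ℂ} (hg : MemLp g 2 unitVol) (k : ℤ) :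
    expBasis.repr (hg.toLp g) k = fcoeff g k := by
  rw [expBasis_repr, fcoeff_congr hg.coeFn_toLp]

theorem ae_eq_of_fcoeff {f g : ℝ → ℂ} (hf : MemLp f 2 unitVol) (hg : MemLp g 2 unitVol)
    (h : ∀ k, fcoeff f k = fcoeff g k) : f =ᵐ[unitVol] g := by
  refine (MemLp.toLp_eq_toLp_iff hf hg).1 (expBasis.repr.injective ?_)
  ext k
  rw [expBasis_repr_toLp, expBasis_repr_toLp, h]

theorem ae_eq_zero_of_fcoeff {f : ℝ → ℂ} (hf : MemLp f 2 unitVol) (h : ∀ k, fcoeff f k = 0) :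
    f =ᵐ[unitVol] 0 :=
  ae_eq_of_fcoeff hf MemLp.zero fun k => by rw [h]; simp [fcoeff]

section synthesis

variable {ι H : Type*} [NormedAddCommGroup H] [InnerProductSpace ℂ H] [CompleteSpace H]
  {κ : Type*} (b : HilbertBasis κ ℂ H) {σ : ι → κ} (hσ : Function.Injective σ)

/-- The isometric embedding of `ℓ²(ι)` that maps the `i`-th unit vector to the basis vector of
index `σ i`. -/
noncomputable def synth : lp (fun _ : ι => ℂ) 2 →ₗᵢ[ℂ] H :=
  (b.orthonormal.comp σ hσ).orthogonalFamily.linearIsometry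

theorem synth_single [DecidableEq ι] (i : ι) : synth b hσ (lp.single 2 i 1) = b (σ i) := by
  simp [synth]

theorem repr_synth (a : lp (fun _ : ι => ℂ) 2) (i : ι) :
    b.repr (synth b hσ a) (σ i) = a i := by
  classical
  rw [HilbertBasis.repr_apply_apply, ← synth_single b hσ i, LinearIsometry.inner_map_map,
    lp.inner_single_left]
  simp

theorem repr_synth_of_notMem (a : lp (fun _ : ι => ℂ) 2) {l : κ} (hl : l ∉ Set.range σ) :
    b.repr (synth b hσ a) l = 0 := by
  have hsum := ((b.orthonormal.comp σ hσ).orthogonalFamily.hasSum_linearIsometry a).mapL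
    (innerSL ℂ (b l))
  rw [HilbertBasis.repr_apply_apply]
  refine hsum.unique ?_
  convert! hasSum_zero with i
  have hne : l ≠ σ i := fun h => hl ⟨i, h.symm⟩
  simp [b.orthonormal.inner_eq_zero hne]

theorem exists_synth_eq {x : H} (hx : ∀ l ∉ Set.range σ, b.repr x l = 0) :
    ∃ a, synth b hσ a = x := by
  have hmem : Memℓp (fun i => b.repr x (σ i)) 2 := by
    rw [memℓp_gen_iff (by norm_num)]
    exact ((lp.memℓp (b.repr x)).summable (by norm_num)).comp_injective hσ
  refine ⟨⟨_, hmem⟩, b.repr.injective ?_⟩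
  ext l
  by_cases hl : l ∈ Set.range σ
  · obtain ⟨i, rfl⟩ := hl
    rw [repr_synth]
  · rw [repr_synth_of_notMem b hσ _ hl, hx l hl]

end synthesis

section polarDecomposition

open ContinuousLinearMap

variable {A H : Type*} [NormedAddCommGroup A] [InnerProductSpace ℂ A] [CompleteSpace A]
  [NormedAddCommGroup H] [InnerProductSpace ℂ H] [CompleteSpace H]

theorem isUnit_adjoint_comp_self (U : A ≃L[ℂ] H) :
    IsUnit (adjoint (U : A →L[ℂ] H) ∘L (U : A →L[ℂ] H)) := by
  have hadj : adjoint (U : A →L[ℂ] H) ∘L adjoint (U.symm : H →L[ℂ] A) = .id ℂ A := by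
    rw [← adjoint_comp, ContinuousLinearEquiv.coe_symm_comp_coe, adjoint_id]
  have hadj' : adjoint (U.symm : H →L[ℂ] A) ∘L adjoint (U : A →L[ℂ] H) = .id ℂ H := by
    rw [← adjoint_comp, ContinuousLinearEquiv.coe_comp_coe_symm, adjoint_id]
  refine isUnit_iff_exists.2
    ⟨(U.symm : H →L[ℂ] A) ∘L adjoint (U.symm : H →L[ℂ] A), ?_, ?_⟩
  · rw [mul_def, comp_assoc, ← comp_assoc (U : A →L[ℂ] H), ContinuousLinearEquiv.coe_comp_coe_symm,
      id_comp, hadj, one_def]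
  · rw [mul_def, comp_assoc, ← comp_assoc (adjoint (U.symm : H →L[ℂ] A)), hadj', id_comp,
      ContinuousLinearEquiv.coe_symm_comp_coe, one_def]

theorem norm_sqrt_apply_sq {P : A →L[ℂ] A} (hP : 0 ≤ P) (x : A) :
    ‖CFC.sqrt P x‖ ^ 2 = (inner ℂ x (P x)).re := by
  have hsa : adjoint (CFC.sqrt P) = CFC.sqrt P :=
    ((nonneg_iff_isPositive _).1 (CFC.sqrt_nonneg P)).isSelfAdjoint.adjoint_eq
  have hsq : CFC.sqrt P ∘L CFC.sqrt P = P := CFC.sqrt_mul_sqrt_self P hP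
  rw [apply_norm_sq_eq_inner_adjoint_right, hsa, hsq]
  rfl

theorem exists_linearIsometryEquiv_of_equiv (U : A ≃L[ℂ] H) : Nonempty (A ≃ₗᵢ[ℂ] H) := by
  let P : A →L[ℂ] A := adjoint (U : A →L[ℂ] H) ∘L (U : A →L[ℂ] H)
  have hP : 0 ≤ P := (nonneg_iff_isPositive _).2 (isPositive_adjoint_comp_self _)
  obtain ⟨Q, hQ⟩ : IsUnit (CFC.sqrt P) := (CFC.isUnit_sqrt_iff P hP).2 (isUnit_adjoint_comp_self U)
  let Qe : A ≃L[ℂ] A := ContinuousLinearEquiv.unitsEquiv ℂ A Q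
  have hnorm : ∀ x, ‖Qe x‖ = ‖U x‖ := fun x => by
    rw [ContinuousLinearEquiv.unitsEquiv_apply, hQ, ← sq_eq_sq₀ (norm_nonneg _) (norm_nonneg _),
      norm_sqrt_apply_sq hP]
    exact (apply_norm_sq_eq_inner_adjoint_right (U : A →L[ℂ] H) x).symm
  exact ⟨⟨(Qe.symm.trans U).toLinearEquiv, fun x =>
    (hnorm (Qe.symm x)).symm.trans (congrArg norm (Qe.apply_symm_apply x))⟩⟩

theorem isRieszBasis_of_equiv {ι : Type*} [DecidableEq ι] (U : lp (fun _ : ι => ℂ) 2 ≃L[ℂ] H) :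
    IsRieszBasis fun i => U (lp.single 2 i 1) := by
  obtain ⟨W⟩ := exists_linearIsometryEquiv_of_equiv U
  refine ⟨HilbertBasis.ofRepr W.symm, W.symm.toContinuousLinearEquiv.trans U, fun i => ?_⟩
  have hb : (HilbertBasis.ofRepr W.symm) i = W (lp.single 2 i 1) := by
    rw [← HilbertBasis.repr_symm_single]; rfl
  rw [hb]
  exact congrArg U (W.symm_apply_apply _).symm

end polarDecomposition

/-- Square integrable functions on the unit interval whose Fourier coefficients vanish outside
`Λ`. -/
def HasSpectrum (g : ℝ → ℂ) (Λ : Set ℤ) : Prop :=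
  MemLp g 2 unitVol ∧ ∀ k ∉ Λ, fcoeff g k = 0

/-- Restriction to `S` is a bijection from the functions with spectrum in `Λ` onto `L²` of
`S ∩ Ioc 0 1`. By the open mapping theorem this says that the exponentials with frequencies in `Λ`
form a Riesz basis of this space. -/
structure IsRieszSpectrum (S : Set ℝ) (Λ : Set ℤ) : Prop where
  ae_eq_zero : ∀ g, HasSpectrum g Λ → (∀ᵐ t ∂unitVol, t ∈ S → g t = 0) → g =ᵐ[unitVol] 0
  exists_eq : ∀ u, MemLp u 2 unitVol → ∃ g, HasSpectrum g Λ ∧ ∀ᵐ t ∂unitVol, t ∈ S → g t = u t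

theorem IsRieszSpectrum.congr {S S' : Set ℝ} {Λ : Set ℤ} (h : IsRieszSpectrum S Λ)
    (hS : ∀ᵐ t ∂unitVol, (t ∈ S ↔ t ∈ S')) : IsRieszSpectrum S' Λ := by
  refine ⟨fun g hg h0 => h.ae_eq_zero g hg ?_, fun u hu => ?_⟩
  · filter_upwards [hS, h0] with t hSt hgt ht using hgt (hSt.1 ht)
  · obtain ⟨g, hg, hgu⟩ := h.exists_eq u hu
    refine ⟨g, hg, ?_⟩
    filter_upwards [hS, hgu] with t hSt hgt ht using hgt (hSt.2 ht)

theorem isRieszSpectrum_univ {S : Set ℝ} (hS : ∀ᵐ t ∂unitVol, t ∈ S) :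
    IsRieszSpectrum S Set.univ where
  ae_eq_zero g _ h0 := by filter_upwards [hS, h0] with t ht hgt using hgt ht
  exists_eq u hu := ⟨u, ⟨hu, fun k hk => absurd (Set.mem_univ k) hk⟩, by simp⟩

theorem isRieszSpectrum_empty {S : Set ℝ} (hS : ∀ᵐ t ∂unitVol, t ∉ S) : IsRieszSpectrum S ∅ where
  ae_eq_zero g hg _ := ae_eq_zero_of_fcoeff hg.1 fun k => hg.2 k (Set.notMem_empty k)
  exists_eq u _ :=
    ⟨0, ⟨MemLp.zero, by simp [fcoeff]⟩, hS.mono fun _ ht htS => absurd htS ht⟩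

section restrictedSynthesis

variable {ι : Type*} {σ : ι → ℤ} (hσ : Function.Injective σ)

theorem hasSpectrum_synth (a : lp (fun _ : ι => ℂ) 2) :
    HasSpectrum (synth expBasis hσ a) (Set.range σ) :=
  ⟨Lp.memLp _, fun k hk => by rw [← expBasis_repr, repr_synth_of_notMem expBasis hσ a hk]⟩

theorem HasSpectrum.exists_synth_ae_eq {g : ℝ → ℂ} (hg : HasSpectrum g (Set.range σ)) :
    ∃ a, synth expBasis hσ a =ᵐ[unitVol] g := by
  obtain ⟨a, ha⟩ := exists_synth_eq expBasis hσ (x := hg.1.toLp g) fun l hl => by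
    rw [expBasis_repr_toLp, hg.2 l hl]
  exact ⟨a, ha ▸ hg.1.coeFn_toLp⟩

/-- The restriction to `S` of the function with frequencies `σ i` and given coefficients. -/
noncomputable def restrictSynth (S : Set ℝ) :
    lp (fun _ : ι => ℂ) 2 →L[ℂ] Lp ℂ 2 (unitVol.restrict S) :=
  LpToLpRestrictCLM ℝ ℂ ℂ unitVol 2 S ∘L (synth expBasis hσ).toContinuousLinearMap

theorem coeFn_restrictSynth (S : Set ℝ) (a : lp (fun _ : ι => ℂ) 2) :
    restrictSynth hσ S a =ᵐ[unitVol.restrict S] synth expBasis hσ a :=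
  LpToLpRestrictCLM_coeFn ℂ S (synth expBasis hσ a)

theorem coeFn_restrictSynth_single [DecidableEq ι] (S : Set ℝ) (i : ι) :
    restrictSynth hσ S (lp.single 2 i 1) =ᵐ[unitVol.restrict S] expFun (σ i) :=
  (coeFn_restrictSynth hσ S _).trans
    (ae_restrict_of_ae (by rw [synth_single]; exact coeFn_expBasis (σ i)))

variable {S : Set ℝ}

theorem IsRieszSpectrum.injective_restrictSynth (h : IsRieszSpectrum S (Set.range σ))
    (hS : MeasurableSet S) : Function.Injective (restrictSynth hσ S) := by
  refine (injective_iff_map_eq_zero _).2 fun a ha => ?_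
  have hzero : ∀ᵐ t ∂unitVol.restrict S, synth expBasis hσ a t = 0 := by
    have hsynth := coeFn_restrictSynth hσ S a
    rw [ha] at hsynth
    filter_upwards [hsynth, Lp.coeFn_zero ℂ 2 (unitVol.restrict S)] with t ht ht0
    rw [← ht, ht0, Pi.zero_apply]
  have hsynth : synth expBasis hσ a = 0 := Lp.eq_zero_iff_ae_eq_zero.2
    (h.ae_eq_zero _ (hasSpectrum_synth hσ a) ((ae_restrict_iff' hS).1 hzero))
  exact (synth expBasis hσ).injective (hsynth.trans (map_zero _).symm)

theorem IsRieszSpectrum.surjective_restrictSynth (h : IsRieszSpectrum S (Set.range σ))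
    (hS : MeasurableSet S) : Function.Surjective (restrictSynth hσ S) := by
  intro v
  obtain ⟨g, hg, hgv⟩ := h.exists_eq (S.indicator v)
    ((memLp_indicator_iff_restrict hS).2 (Lp.memLp v))
  obtain ⟨a, ha⟩ := hg.exists_synth_ae_eq hσ
  refine ⟨a, Lp.ext ((coeFn_restrictSynth hσ S a).trans ?_)⟩
  filter_upwards [ae_restrict_of_ae ha, (ae_restrict_iff' hS).2 hgv, ae_restrict_mem hS]
    with t hat hgt ht
  rw [hat, hgt, Set.indicator_of_mem ht]

theorem IsRieszSpectrum.isExpRieszBasis {Λ : Set ℤ} (h : IsRieszSpectrum S Λ)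
    (hS : MeasurableSet S) (hSvol : volume.restrict S = unitVol.restrict S) :
    IsExpRieszBasis S ((fun k : ℤ => (k : ℝ)) '' Λ) := by
  classical
  let e : Λ ≃ (fun k : ℤ => (k : ℝ)) '' Λ := Equiv.Set.image _ Λ Int.cast_injective
  let σ : (fun k : ℤ => (k : ℝ)) '' Λ → ℤ := Subtype.val ∘ e.symm
  have hσ : Function.Injective σ := Subtype.val_injective.comp e.symm.injective
  have hrange : Set.range σ = Λ := by
    rw [Set.range_comp, e.symm.range_eq_univ, Set.image_univ, Subtype.range_coe]
  have hcast : ∀ l, (σ l : ℝ) = l := fun l => congrArg Subtype.val (e.apply_symm_apply l)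
  rw [← hrange] at h
  let U := ContinuousLinearEquiv.ofBijective (restrictSynth hσ S)
    (LinearMap.ker_eq_bot.2 (h.injective_restrictSynth hσ hS))
    (LinearMap.range_eq_top.2 (h.surjective_restrictSynth hσ hS))
  rw [IsExpRieszBasis, hSvol]
  exact ⟨_, fun l => hcast l ▸ coeFn_restrictSynth_single hσ S l, isRieszBasis_of_equiv U⟩

end restrictedSynthesis

/-! ### Folding by `t ↦ N * t` -/

section composition

variable {α β E : Type*} [MeasurableSpace α] [MeasurableSpace β] [NormedAddCommGroup E]
  {μ : Measure α} {ν : Measure β} {φ : α → β} {c : ENNReal}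

theorem memLp_comp_of_map_le {p : ENNReal} (hφ : Measurable φ) (hc : c ≠ ⊤) (h : μ.map φ ≤ c • ν)
    {g : β → E} (hg : MemLp g p ν) : MemLp (g ∘ φ) p μ :=
  (hg.of_measure_le_smul hc h).comp_of_map hφ.aemeasurable

theorem quasiMeasurePreserving_of_map_le (hφ : Measurable φ) (h : μ.map φ ≤ c • ν) :
    Measure.QuasiMeasurePreserving φ μ ν :=
  ⟨hφ, Measure.absolutelyContinuous_of_le_smul h⟩

end composition

theorem map_affine_unitVol_le {a b : ℝ} (ha : 0 < a)
    (h : ∀ y ∈ Set.Ioc (0 : ℝ) 1, a * y + b ∈ Set.Ioc (0 : ℝ) 1) :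
    unitVol.map (fun y => a * y + b) ≤ ENNReal.ofReal a⁻¹ • unitVol := by
  have hmeas : Measurable fun y : ℝ => a * y + b := by fun_prop
  refine Measure.le_iff.2 fun s hs => ?_
  rw [Measure.map_apply hmeas hs, Measure.restrict_apply (hmeas hs), Measure.smul_apply,
    Measure.restrict_apply hs, smul_eq_mul]
  calc volume ((fun y => a * y + b) ⁻¹' s ∩ Set.Ioc 0 1)
      ≤ volume ((fun y => a * y) ⁻¹' ((fun y => y + b) ⁻¹' (s ∩ Set.Ioc 0 1))) :=
        measure_mono fun y hy => ⟨hy.1, h y hy.2⟩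
    _ = ENNReal.ofReal a⁻¹ * volume (s ∩ Set.Ioc 0 1) := by
        rw [Real.volume_preimage_mul_left ha.ne', measure_preimage_add_right,
          abs_of_pos (inv_pos.2 ha)]

theorem quasiMeasurePreserving_affine {a : ℝ} (b : ℝ) (ha : a ≠ 0) :
    Measure.QuasiMeasurePreserving (fun y : ℝ => a * y + b) volume volume := by
  refine ⟨by fun_prop, Measure.AbsolutelyContinuous.mk fun s hs h0 => ?_⟩
  rw [Measure.map_apply (by fun_prop) hs]
  change volume ((fun y => a * y) ⁻¹' ((fun y => y + b) ⁻¹' s)) = 0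
  rw [Real.volume_preimage_mul_left ha, measure_preimage_add_right, h0, mul_zero]

theorem memLp_expFun_mul {g : ℝ → ℂ} (hg : MemLp g 2 unitVol) (l : ℝ) {φ : ℝ → ℝ}
    (hφ : Continuous φ) : MemLp (fun t => expFun l (φ t) * g t) 2 unitVol :=
  hg.of_le (((continuous_expFun l).comp hφ).aestronglyMeasurable.mul hg.1)
    (Eventually.of_forall fun t => by simp [norm_expFun])

section foldPoints

variable {N : ℕ} {X : Type*} [NormedAddCommGroup X]

theorem foldPt_mem {j : ℕ} (hj : j < N) {y : ℝ} (hy : y ∈ Set.Ioc (0 : ℝ) 1) :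
    (y + j) / N ∈ Set.Ioc (0 : ℝ) 1 := by
  have hN : (0 : ℝ) < N := by exact_mod_cast (Nat.zero_le j).trans_lt hj
  have hjN : (j : ℝ) + 1 ≤ N := by exact_mod_cast hj
  refine ⟨div_pos (by linarith [hy.1, (Nat.cast_nonneg j : (0 : ℝ) ≤ j)]) hN, ?_⟩
  rw [div_le_one hN]; linarith [hy.2]

theorem map_foldPt_le {j : ℕ} (hj : j < N) :
    unitVol.map (fun y : ℝ => (y + j) / N) ≤ ENNReal.ofReal ((N : ℝ)⁻¹)⁻¹ • unitVol := by
  have hN : (0 : ℝ) < N := by exact_mod_cast (Nat.zero_le j).trans_lt hj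
  have haffine : (fun y : ℝ => (y + j) / N) = fun y => (N : ℝ)⁻¹ * y + j / N := by
    ext y; field_simp
  rw [haffine]
  refine map_affine_unitVol_le (inv_pos.2 hN) fun y hy => ?_
  rw [← congrFun haffine y]
  exact foldPt_mem hj hy

theorem memLp_comp_foldPt {q : ENNReal} {j : ℕ} (hj : j < N) {g : ℝ → X}
    (hg : MemLp g q unitVol) : MemLp (fun y : ℝ => g ((y + j) / N)) q unitVol :=
  memLp_comp_of_map_le (by fun_prop) ENNReal.ofReal_ne_top (map_foldPt_le hj) hg

theorem ae_forall_lt {P : ℕ → ℝ → Prop} (h : ∀ n < N, ∀ᵐ y ∂unitVol, P n y) :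
    ∀ᵐ y ∂unitVol, ∀ n < N, P n y :=
  (eventually_all_finite (Set.finite_lt_nat N)).2 h

theorem ae_foldPt {P : ℝ → Prop} (h : ∀ᵐ t ∂unitVol, P t) :
    ∀ᵐ y ∂unitVol, ∀ j < N, P ((y + j) / N) :=
  ae_forall_lt fun _ hj => (quasiMeasurePreserving_of_map_le (by fun_prop) (map_foldPt_le hj)).ae h

theorem exists_foldPt_eq (hN : 0 < N) {t : ℝ} (ht : t ∈ Set.Ioc (0 : ℝ) 1) :
    ∃ j < N, N * t + -(j : ℝ) ∈ Set.Ioc (0 : ℝ) 1 := by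
  have hpos : 0 < (N : ℝ) * t := mul_pos (by exact_mod_cast hN) ht.1
  obtain ⟨j, hj⟩ : ∃ j, ⌈(N : ℝ) * t⌉₊ = j + 1 :=
    ⟨_, (Nat.succ_pred_eq_of_pos (Nat.ceil_pos.2 hpos)).symm⟩
  have hle : (N : ℝ) * t ≤ j + 1 := by
    exact_mod_cast hj ▸ Nat.le_ceil ((N : ℝ) * t)
  have hlt : (j : ℝ) < N * t := by
    have := Nat.ceil_lt_add_one hpos.le
    rw [hj] at this; push_cast at this; linarith
  refine ⟨j, ?_, by linarith, by linarith⟩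
  exact_mod_cast hlt.trans_le (mul_le_of_le_one_right (Nat.cast_nonneg N) ht.2)

theorem ae_of_ae_foldPt (hN : 0 < N) {P : ℝ → Prop}
    (h : ∀ᵐ y ∂unitVol, ∀ j < N, P ((y + j) / N)) : ∀ᵐ t ∂unitVol, P t := by
  have hN0 : (N : ℝ) ≠ 0 := by exact_mod_cast hN.ne'
  rw [ae_restrict_iff' measurableSet_Ioc] at h ⊢
  have hunfold : ∀ᵐ t : ℝ, ∀ j : ℕ, (N : ℝ) * t + -(j : ℝ) ∈ Set.Ioc (0 : ℝ) 1 →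
      ∀ i < N, P (((N : ℝ) * t + -(j : ℝ) + i) / N) :=
    ae_all_iff.2 fun j => (quasiMeasurePreserving_affine (-(j : ℝ)) hN0).ae h
  filter_upwards [hunfold] with t ht htI
  obtain ⟨j, hj, hmem⟩ := exists_foldPt_eq hN htI
  have hP := ht j hmem j hj
  rwa [neg_add_cancel_right, mul_div_cancel_left₀ t hN0] at hP

variable [NormedSpace ℝ X]

theorem integral_comp_foldPt (N : ℕ) (F : ℝ → X) (j : ℕ) :
    (N : ℝ)⁻¹ • ∫ y in (0 : ℝ)..1, F ((y + j) / N) =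
      ∫ t in (j : ℝ) / N..((j + 1 : ℕ) : ℝ) / N, F t := by
  have hsubst := intervalIntegral.inv_smul_integral_comp_div_add (a := 0) (b := 1) F N (j / N : ℝ)
  simp only [← add_div, zero_add] at hsubst
  rw [Nat.cast_succ, add_comm (j : ℝ) 1, ← hsubst]

theorem integral_unitVol_foldPt (hN : 0 < N) {F : ℝ → X} (hF : Integrable F unitVol) :
    ∫ t, F t ∂unitVol = ∑ j ∈ Finset.range N, (N : ℝ)⁻¹ • ∫ y, F ((y + j) / N) ∂unitVol := by
  have hN0 : (0 : ℝ) < N := by exact_mod_cast hN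
  have hint : ∀ j < N, IntervalIntegrable F volume (j / N) ((j + 1 : ℕ) / N) := by
    intro j hj
    rw [intervalIntegrable_iff_integrableOn_Ioc_of_le (by gcongr; simp)]
    refine IntegrableOn.mono_set hF (Set.Ioc_subset_Ioc (by positivity) ?_)
    rw [div_le_one hN0]; exact_mod_cast hj
  simp only [← intervalIntegral.integral_of_le zero_le_one, integral_comp_foldPt]
  rw [intervalIntegral.sum_integral_adjacent_intervals (a := fun j : ℕ => (j : ℝ) / N) hint]
  simp [hN0.ne']

end foldPoints

section foldComponents

variable {N : ℕ}

/-- The component of `g` with frequencies in `Nℤ + n`, multiplied by `e_{-n}` and written as a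
function of `y = N * t` on the unit interval. -/
noncomputable def foldComp (N : ℕ) (g : ℝ → ℂ) (n : ℕ) (y : ℝ) : ℂ :=
  ∑ j ∈ Finset.range N, (N : ℂ)⁻¹ * (expFun (-n) ((y + j) / N) * g ((y + j) / N))

theorem memLp_foldComp_summand {g : ℝ → ℂ} (hg : MemLp g 2 unitVol) (n : ℕ) {j : ℕ} (hj : j < N) :
    MemLp (fun y => (N : ℂ)⁻¹ * (expFun (-n) ((y + j) / N) * g ((y + j) / N))) 2 unitVol :=
  (memLp_expFun_mul (memLp_comp_foldPt hj hg) (-n) (φ := fun y => (y + j) / N)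
    (by fun_prop)).const_mul _

theorem memLp_foldComp {g : ℝ → ℂ} (hg : MemLp g 2 unitVol) (n : ℕ) :
    MemLp (foldComp N g n) 2 unitVol :=
  memLp_finsetSum _ fun _ hj => memLp_foldComp_summand hg n (Finset.mem_range.1 hj)

theorem expFun_neg_foldPt (hN : 0 < N) (k : ℤ) (n j : ℕ) (y : ℝ) :
    expFun (-(N * k + n : ℤ)) ((y + j) / N) = expFun (-k) y * expFun (-n) ((y + j) / N) := by
  have hN0 : (N : ℝ) ≠ 0 := by exact_mod_cast hN.ne'
  have hperiod : expFun (-k) (j : ℝ) = 1 := by simpa using expFun_int_int (-k) j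
  have hscale : expFun (-(N * k : ℝ)) ((y + j) / N) = expFun (-k) (y + j) :=
    expFun_congr (by field_simp)
  push_cast
  rw [neg_add, expFun_add_left, hscale, expFun_add_right, hperiod, mul_one]

theorem fcoeff_foldComp (hN : 0 < N) {g : ℝ → ℂ} (hg : MemLp g 2 unitVol) (n : ℕ) (k : ℤ) :
    fcoeff (foldComp N g n) k = fcoeff g (N * k + n) := by
  have hint : ∀ {f : ℝ → ℂ}, MemLp f 2 unitVol → ∀ l : ℝ,
      Integrable (fun t => expFun l t * f t) unitVol := fun hf l =>
    (memLp_expFun_mul hf l continuous_id).integrable one_le_two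
  rw [fcoeff, fcoeff, integral_unitVol_foldPt hN (hint hg _)]
  simp only [foldComp, Finset.mul_sum]
  rw [integral_finsetSum _ fun j hj =>
    hint (memLp_foldComp_summand hg n (Finset.mem_range.1 hj)) _]
  refine Finset.sum_congr rfl fun j _ => ?_
  rw [Complex.real_smul, Complex.ofReal_inv, Complex.ofReal_natCast, ← integral_const_mul]
  refine integral_congr_ae (Eventually.of_forall fun y => ?_)
  simp only [expFun_neg_foldPt hN]
  ring

theorem expFun_one_div_injOn (N : ℕ) :
    Set.InjOn (fun j : ℕ => expFun 1 (j / N)) (Finset.range N) := by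
  intro j hj l hl h
  have hj' := Finset.mem_range.1 hj
  have hpow : ∀ i : ℕ, expFun 1 (i / N) = Complex.exp (2 * Real.pi * Complex.I / N) ^ i := by
    intro i
    rw [expFun, ← Complex.exp_nat_mul]
    congr 1; push_cast; ring
  simp only [hpow] at h
  exact (Complex.isPrimitiveRoot_exp N (by lia)).pow_inj hj' (Finset.mem_range.1 hl) h

theorem sum_expFun_root {j l : ℕ} (hj : j < N) (hl : l < N) :
    ∑ n ∈ Finset.range N, expFun n (((j : ℝ) - l) / N) = if j = l then (N : ℂ) else 0 := by
  split_ifs with h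
  · simp [h, expFun_zero_right]
  · have hN0 : (N : ℝ) ≠ 0 := by exact_mod_cast (Nat.zero_lt_of_lt hj).ne'
    have hne : expFun 1 (((j : ℝ) - l) / N) ≠ 1 := fun hone => h <|
      expFun_one_div_injOn N (Finset.mem_range.2 hj) (Finset.mem_range.2 hl) <| by
        change expFun 1 (j / N) = expFun 1 (l / N)
        rw [← sub_add_cancel ((j : ℝ) / N) (l / N), ← sub_div, expFun_add_right, hone, one_mul]
    have hroot : expFun 1 (((j : ℝ) - l) / N) ^ N = 1 := by
      rw [expFun_pow, mul_one, expFun_eq_one_iff]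
      exact ⟨j - l, by push_cast; field_simp⟩
    calc ∑ n ∈ Finset.range N, expFun n (((j : ℝ) - l) / N)
        = ∑ n ∈ Finset.range N, expFun 1 (((j : ℝ) - l) / N) ^ n :=
          Finset.sum_congr rfl fun n _ => by rw [expFun_pow, mul_one]
      _ = 0 := by rw [geom_sum_eq hne, hroot, sub_self, zero_div]

theorem sum_foldComp (g : ℝ → ℂ) (y : ℝ) {j : ℕ} (hj : j < N) :
    ∑ n ∈ Finset.range N, expFun n ((y + j) / N) * foldComp N g n y = g ((y + j) / N) := by
  have hN0 : (N : ℂ) ≠ 0 := by exact_mod_cast (Nat.zero_lt_of_lt hj).ne'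
  have hphase : ∀ n l : ℕ, expFun n ((y + j) / N) * expFun (-n) ((y + l) / N) =
      expFun n (((j : ℝ) - l) / N) := by
    intro n l
    have hneg : expFun (-n) ((y + l) / N) = expFun n (-((y + l) / N)) := expFun_congr (by ring)
    rw [hneg, ← expFun_add_right]
    congr 1; ring
  calc ∑ n ∈ Finset.range N, expFun n ((y + j) / N) * foldComp N g n y
      = ∑ l ∈ Finset.range N, (∑ n ∈ Finset.range N, expFun n (((j : ℝ) - l) / N)) *
          ((N : ℂ)⁻¹ * g ((y + l) / N)) := by
        simp only [foldComp, Finset.mul_sum, Finset.sum_mul, ← hphase]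
        rw [Finset.sum_comm]
        exact Finset.sum_congr rfl fun l _ => Finset.sum_congr rfl fun n _ => by ring
    _ = ∑ l ∈ Finset.range N, if j = l then g ((y + l) / N) else 0 := by
        refine Finset.sum_congr rfl fun l hl => ?_
        rw [sum_expFun_root hj (Finset.mem_range.1 hl)]
        split_ifs
        · rw [mul_inv_cancel_left₀ hN0]
        · rw [zero_mul]
    _ = g ((y + j) / N) := by rw [Finset.sum_ite_eq, if_pos (Finset.mem_range.2 hj)]

theorem progression_unique {n n' : ℕ} (hn : n < N) (hn' : n' < N) {k l : ℤ}
    (h : (N : ℤ) * k + n = N * l + n') : n = n' ∧ k = l := by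
  have hmod : ∀ {i : ℕ} (_ : i < N) (q : ℤ), ((N : ℤ) * q + i) % N = i := fun hi q => by
    rw [Int.mul_add_emod_self_left, Int.emod_eq_of_lt (by lia) (by lia)]
  have hnn : (n : ℤ) = n' := by rw [← hmod hn k, ← hmod hn' l, h]
  refine ⟨by exact_mod_cast hnn, ?_⟩
  rw [hnn, add_left_inj] at h
  exact mul_left_cancel₀ (by lia) h

theorem exists_eq_mul_add (hN : 0 < N) (k : ℤ) : ∃ n < N, ∃ l : ℤ, k = N * l + n := by
  have hN' : (0 : ℤ) < N := by exact_mod_cast hN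
  have hnonneg := Int.emod_nonneg k hN'.ne'
  have hlt := Int.emod_lt_of_pos k hN'
  refine ⟨(k % N).toNat, by lia, k / N, ?_⟩
  rw [Int.toNat_of_nonneg hnonneg, Int.mul_ediv_add_emod]

theorem exists_fcoeff_progression (hN : 0 < N) {H : ℕ → ℝ → ℂ} (hH : ∀ n, MemLp (H n) 2 unitVol) :
    ∃ g, MemLp g 2 unitVol ∧ ∀ n < N, ∀ k : ℤ, fcoeff g (N * k + n) = fcoeff (H n) k := by
  have hσ : ∀ n : ℕ, Function.Injective fun k : ℤ => (N : ℤ) * k + n := fun n a b h => by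
    simpa [hN.ne'] using h
  let G : ℕ → Lp ℂ 2 unitVol := fun n =>
    synth expBasis (hσ n) (expBasis.repr ((hH n).toLp (H n)))
  refine ⟨(∑ n ∈ Finset.range N, G n : Lp ℂ 2 unitVol), Lp.memLp _, fun n hn k => ?_⟩
  have hsum : expBasis.repr (∑ n ∈ Finset.range N, G n) (N * k + n) =
      ∑ m ∈ Finset.range N, expBasis.repr (G m) (N * k + n) := by
    rw [map_sum, lp.coeFn_sum, Finset.sum_apply]
  rw [← expBasis_repr, hsum, Finset.sum_eq_single_of_mem n (Finset.mem_range.2 hn)]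
  · rw [repr_synth expBasis (hσ n), expBasis_repr_toLp]
  · intro m hm hmn
    refine repr_synth_of_notMem expBasis (hσ m) _ ?_
    rintro ⟨l, hl⟩
    exact hmn (progression_unique (Finset.mem_range.1 hm) hn hl).1

end foldComponents

section foldIndices

variable {N : ℕ} {S : Set ℝ}

open scoped Classical in
/-- The indices `j < N` of the points `(y + j) / N` that lie in `S`. -/
noncomputable def foldIndices (N : ℕ) (S : Set ℝ) (y : ℝ) : Finset ℕ :=
  {j ∈ Finset.range N | (y + j) / N ∈ S}

theorem mem_foldIndices {y : ℝ} {j : ℕ} : j ∈ foldIndices N S y ↔ j < N ∧ (y + j) / N ∈ S := by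
  simp [foldIndices]

theorem foldIndices_subset_range (N : ℕ) (S : Set ℝ) (y : ℝ) :
    foldIndices N S y ⊆ Finset.range N :=
  fun _ hj => Finset.mem_range.2 (mem_foldIndices.1 hj).1

theorem measurableSet_foldIndices_eq (N : ℕ) (hS : MeasurableSet S) (J : Finset ℕ) :
    MeasurableSet {y | foldIndices N S y = J} := by
  have hInter : {y | foldIndices N S y = J} =
      ⋂ j : ℕ, {y : ℝ | (j < N ∧ (y + j) / N ∈ S) ↔ j ∈ J} := by
    ext y; simp [Finset.ext_iff, mem_foldIndices]
  rw [hInter]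
  refine MeasurableSet.iInter fun j => ?_
  have hpreimage : MeasurableSet {y : ℝ | (y + j) / N ∈ S} :=
    (show Measurable fun y : ℝ => (y + j) / N by fun_prop) hS
  exact ((MeasurableSet.const _).inter hpreimage).iff (MeasurableSet.const _)

/-- The points over which the folding `t ↦ N * t` of `S` has more than `n` sheets. -/
def foldLevel (N : ℕ) (S : Set ℝ) (n : ℕ) : Set ℝ := {y | n < (foldIndices N S y).card}

theorem mem_foldLevel {n : ℕ} {y : ℝ} : y ∈ foldLevel N S n ↔ n < (foldIndices N S y).card :=
  Iff.rfl

end foldIndices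

section vandermonde

open Polynomial

variable {F ι : Type*} [Field F] [DecidableEq ι] {s : Finset ι} {v : ι → F}

theorem sum_mul_pow_eq_iff_eq_coeff_interpolate (hv : Set.InjOn v s) (c : ℕ → F) (r : ι → F) :
    (∀ i ∈ s, ∑ n ∈ Finset.range s.card, c n * v i ^ n = r i) ↔
      ∀ n < s.card, c n = (Lagrange.interpolate s v r).coeff n := by
  let p : F[X] := ∑ n ∈ Finset.range s.card, C (c n) * X ^ n
  have hcoeff : ∀ n, p.coeff n = if n < s.card then c n else 0 := fun n => by
    simp [p, coeff_X_pow]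
  have heval : ∀ x, p.eval x = ∑ n ∈ Finset.range s.card, c n * x ^ n := fun x => by
    simp [p, eval_finsetSum]
  have hdeg : p.degree < s.card := degree_lt_iff_coeff_zero _ _ |>.2 fun n hn => by
    rw [hcoeff, if_neg (by exact_mod_cast hn.not_gt)]
  simp only [← heval]
  rw [← and_iff_right (b := ∀ i ∈ s, p.eval (v i) = r i) hdeg,
    Lagrange.eq_interpolate_iff r hv, ext_iff]
  refine forall_congr' fun n => ?_
  rw [hcoeff]
  split_ifs with hn
  · simp only [hn, forall_const]
  · have hzero : (Lagrange.interpolate s v r).coeff n = 0 :=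
      coeff_eq_zero_of_degree_lt ((Lagrange.degree_interpolate_lt r hv).trans_le
        (by exact_mod_cast not_lt.1 hn))
    simp only [hn, hzero, false_imp_iff]

end vandermonde

section foldTarget

variable {N : ℕ}

/-- The remainder of `u` at the point `(y + j) / N` after removing the components `H m` of index
`m ≥ k`. -/
noncomputable def foldRem (N : ℕ) (u : ℝ → ℂ) (H : ℕ → ℝ → ℂ) (k : ℕ) (y : ℝ) (j : ℕ) : ℂ :=
  u ((y + j) / N) - ∑ m ∈ Finset.Ico k N, expFun m ((y + j) / N) * H m y

/-- The value at `y` that the component of index `n < #J` must take for the components to sum to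
`u` at the points `(y + j) / N`, `j ∈ J`, once the components of index at least `#J` are given. -/
noncomputable def foldTarget (N : ℕ) (u : ℝ → ℂ) (H : ℕ → ℝ → ℂ) (n : ℕ) (J : Finset ℕ)
    (y : ℝ) : ℂ :=
  expFun (-n) (y / N) *
    (Lagrange.interpolate J (fun j : ℕ => expFun 1 (j / N)) (foldRem N u H J.card y)).coeff n

theorem expFun_foldPt (N n j : ℕ) (y : ℝ) :
    expFun n ((y + j) / N) = expFun n (y / N) * expFun 1 (j / N) ^ n := by
  rw [expFun_pow, mul_one, add_div, expFun_add_right]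

-- At a fixed `y` the equations form a square Vandermonde system for the first `#J` components.
theorem forall_sum_eq_iff_eq_foldTarget {J : Finset ℕ} (hJ : J ⊆ Finset.range N) (u : ℝ → ℂ)
    (H : ℕ → ℝ → ℂ) (y : ℝ) :
    (∀ j ∈ J, ∑ n ∈ Finset.range N, expFun n ((y + j) / N) * H n y = u ((y + j) / N)) ↔
      ∀ n < J.card, H n y = foldTarget N u H n J y := by
  have hinj := (expFun_one_div_injOn N).mono (Finset.coe_subset.2 hJ)
  have hcard : J.card ≤ N := (Finset.card_le_card hJ).trans_eq (Finset.card_range N)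
  have hcancel : ∀ n : ℕ, expFun n (y / N) * expFun (-n) (y / N) = 1 := fun n => by
    rw [← expFun_add_left, add_neg_cancel, expFun_zero_left]
  calc (∀ j ∈ J, ∑ n ∈ Finset.range N, expFun n ((y + j) / N) * H n y = u ((y + j) / N))
      ↔ ∀ j ∈ J, ∑ n ∈ Finset.range J.card, expFun n (y / N) * H n y * expFun 1 (j / N) ^ n =
          foldRem N u H J.card y j := by
        refine forall₂_congr fun j _ => ?_
        rw [foldRem, eq_sub_iff_add_eq, ← Finset.sum_range_add_sum_Ico _ hcard]
        simp only [expFun_foldPt, mul_right_comm]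
    _ ↔ ∀ n < J.card, expFun n (y / N) * H n y = (Lagrange.interpolate J
          (fun j : ℕ => expFun 1 (j / N)) (foldRem N u H J.card y)).coeff n :=
        sum_mul_pow_eq_iff_eq_coeff_interpolate hinj _ _
    _ ↔ ∀ n < J.card, H n y = foldTarget N u H n J y := by
        refine forall₂_congr fun n _ => ?_
        rw [foldTarget, ← mul_right_inj' (b := H n y) (expFun_ne_zero n (y / N)),
          ← mul_assoc, hcancel, one_mul]

theorem foldTarget_congr {u : ℝ → ℂ} {H H' : ℕ → ℝ → ℂ} {J : Finset ℕ} {y : ℝ}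
    (h : ∀ m < N, J.card ≤ m → H m y = H' m y) (n : ℕ) :
    foldTarget N u H n J y = foldTarget N u H' n J y := by
  have hrem : foldRem N u H J.card y = foldRem N u H' J.card y := by
    ext j
    rw [foldRem, foldRem, Finset.sum_congr rfl fun m hm => by rw [h m (Finset.mem_Ico.1 hm).2
      (Finset.mem_Ico.1 hm).1]]
  rw [foldTarget, foldTarget, hrem]

theorem foldTarget_zero (N n : ℕ) (J : Finset ℕ) (y : ℝ) : foldTarget N 0 0 n J y = 0 := by
  have hrem : foldRem N 0 0 J.card y = 0 := by ext j; simp [foldRem]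
  rw [foldTarget, hrem, map_zero, Polynomial.coeff_zero, mul_zero]

theorem memLp_foldTarget {u : ℝ → ℂ} (hu : MemLp u 2 unitVol) {H : ℕ → ℝ → ℂ}
    (hH : ∀ n, MemLp (H n) 2 unitVol) (n : ℕ) {J : Finset ℕ} (hJ : J ⊆ Finset.range N) :
    MemLp (foldTarget N u H n J) 2 unitVol := by
  refine memLp_expFun_mul ?_ _ (φ := fun y => y / N) (by fun_prop)
  simp only [Lagrange.interpolate_apply, Polynomial.finsetSum_coeff, Polynomial.coeff_C_mul]
  refine memLp_finsetSum J fun j hj => MemLp.mul_const ?_ _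
  exact (memLp_comp_foldPt (Finset.mem_range.1 (hJ hj)) hu).sub <| memLp_finsetSum _ fun m _ =>
    memLp_expFun_mul (hH m) _ (φ := fun y => (y + j) / N) (by fun_prop)

theorem memLp_foldTarget_foldIndices {S : Set ℝ} (hS : MeasurableSet S) {u : ℝ → ℂ}
    (hu : MemLp u 2 unitVol) {H : ℕ → ℝ → ℂ} (hH : ∀ n, MemLp (H n) 2 unitVol) (n : ℕ) :
    MemLp (fun y => foldTarget N u H n (foldIndices N S y) y) 2 unitVol := by
  have hsum : (fun y => foldTarget N u H n (foldIndices N S y) y) = fun y =>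
      ∑ J ∈ (Finset.range N).powerset,
        Set.indicator {y | foldIndices N S y = J} (foldTarget N u H n J) y := by
    ext y
    simp only [Set.indicator_apply, Set.mem_ofPred_eq]
    rw [Finset.sum_ite_eq, if_pos (Finset.mem_powerset.2 (foldIndices_subset_range N S y))]
  rw [hsum]
  exact memLp_finsetSum _ fun J hJ =>
    (memLp_foldTarget hu hH n (Finset.mem_powerset.1 hJ)).indicator
      (measurableSet_foldIndices_eq N hS J)

end foldTarget

section fold

variable {N : ℕ} {S : Set ℝ} {Λ : ℕ → Set ℤ}

/-- The frequencies `N * l + n` with `l ∈ Λ n` and `n < N`. -/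
def interleave (N : ℕ) (Λ : ℕ → Set ℤ) : Set ℤ := {k | ∃ n < N, ∃ l ∈ Λ n, k = N * l + n}

theorem mem_interleave_iff {n : ℕ} (hn : n < N) {l : ℤ} :
    (N * l + n : ℤ) ∈ interleave N Λ ↔ l ∈ Λ n := by
  refine ⟨?_, fun hl => ⟨n, hn, l, hl, rfl⟩⟩
  rintro ⟨n', hn', l', hl', heq⟩
  obtain ⟨rfl, rfl⟩ := progression_unique hn hn' heq
  exact hl'

theorem HasSpectrum.foldComp (hN : 0 < N) {g : ℝ → ℂ} (hg : HasSpectrum g (interleave N Λ))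
    {n : ℕ} (hn : n < N) : HasSpectrum (foldComp N g n) (Λ n) :=
  ⟨memLp_foldComp hg.1 n, fun k hk => by
    rw [fcoeff_foldComp hN hg.1, hg.2 _ fun hmem => hk ((mem_interleave_iff hn).1 hmem)]⟩

theorem IsRieszSpectrum.foldComp_ae_eq_zero (hN : 0 < N)
    (h : ∀ n < N, IsRieszSpectrum (foldLevel N S n) (Λ n)) {g : ℝ → ℂ}
    (hg : HasSpectrum g (interleave N Λ)) (h0 : ∀ᵐ t ∂unitVol, t ∈ S → g t = 0) (n : ℕ) :
    n < N → foldComp N g n =ᵐ[unitVol] 0 := by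
  induction n using Nat.strong_decreasing_induction with
  | base => exact ⟨N, fun m hm hmN => absurd hmN hm.not_gt⟩
  | step n ih =>
    intro hn
    refine (h n hn).ae_eq_zero _ (hg.foldComp hN hn) ?_
    have hhigh : ∀ᵐ y ∂unitVol, ∀ m < N, n < m → foldComp N g m y = 0 :=
      ae_forall_lt fun m hm => by
        by_cases hnm : n < m
        · exact (ih m hnm hm).mono fun y hy _ => hy
        · exact Eventually.of_forall fun y hnm' => absurd hnm' hnm
    filter_upwards [hhigh, ae_foldPt (N := N) h0] with y hy hy0 hlevel
    have htarget := (forall_sum_eq_iff_eq_foldTarget (foldIndices_subset_range N S y) 0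
      (fun m => foldComp N g m) y).1 (fun j hj => by
        obtain ⟨hjN, hjS⟩ := mem_foldIndices.1 hj
        rw [sum_foldComp g y hjN, hy0 j hjN hjS, Pi.zero_apply])
    rw [htarget n hlevel, foldTarget_congr (H' := 0)
      (fun m hm hcard => hy m hm (hlevel.trans_le hcard)), foldTarget_zero]

theorem IsRieszSpectrum.interleave_ae_eq_zero (hN : 0 < N)
    (h : ∀ n < N, IsRieszSpectrum (foldLevel N S n) (Λ n)) {g : ℝ → ℂ}
    (hg : HasSpectrum g (interleave N Λ)) (h0 : ∀ᵐ t ∂unitVol, t ∈ S → g t = 0) :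
    g =ᵐ[unitVol] 0 := by
  refine ae_of_ae_foldPt hN ?_
  filter_upwards [ae_forall_lt fun n hn => IsRieszSpectrum.foldComp_ae_eq_zero hN h hg h0 n hn]
    with y hy j hj
  rw [← sum_foldComp g y hj]
  exact Finset.sum_eq_zero fun n hn => by
    rw [hy n (Finset.mem_range.1 hn), Pi.zero_apply, mul_zero]

theorem IsRieszSpectrum.exists_fold_components (hS : MeasurableSet S)
    (h : ∀ n < N, IsRieszSpectrum (foldLevel N S n) (Λ n)) {u : ℝ → ℂ} (hu : MemLp u 2 unitVol)
    {k : ℕ} (hk : k ≤ N) : ∃ H : ℕ → ℝ → ℂ, (∀ n, MemLp (H n) 2 unitVol) ∧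
      ∀ n < N, k ≤ n → HasSpectrum (H n) (Λ n) ∧ ∀ᵐ y ∂unitVol, y ∈ foldLevel N S n →
        H n y = foldTarget N u H n (foldIndices N S y) y := by
  induction hk using Nat.decreasingInduction with
  | self => exact ⟨0, fun _ => MemLp.zero, fun n hn hle => absurd hn hle.not_gt⟩
  | of_succ k hk ih =>
    obtain ⟨H, hH, htarget⟩ := ih
    obtain ⟨g, hg, hgtarget⟩ := (h k hk).exists_eq _ (memLp_foldTarget_foldIndices hS hu hH k)
    have hupdate : ∀ n y, k ≤ n → y ∈ foldLevel N S n →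
        foldTarget N u (Function.update H k g) n (foldIndices N S y) y =
          foldTarget N u H n (foldIndices N S y) y := fun n y hkn hlevel =>
      foldTarget_congr (fun m _ hm => by
        rw [Function.update_of_ne (hkn.trans_lt ((mem_foldLevel.1 hlevel).trans_le hm)).ne']) n
    refine ⟨Function.update H k g, fun n => ?_, fun n hn hkn => ?_⟩
    · rcases eq_or_ne n k with rfl | hne
      · rw [Function.update_self]; exact hg.1
      · rw [Function.update_of_ne hne]; exact hH n
    · rcases eq_or_ne n k with rfl | hne
      · rw [Function.update_self]
        exact ⟨hg, hgtarget.mono fun y hy hlevel => by rw [hupdate n y le_rfl hlevel, hy hlevel]⟩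
      · rw [Function.update_of_ne hne]
        obtain ⟨hspec, hy⟩ := htarget n hn (hkn.lt_of_ne hne.symm)
        exact ⟨hspec, hy.mono fun y hy hlevel => by rw [hupdate n y hkn hlevel, hy hlevel]⟩

theorem IsRieszSpectrum.interleave_exists_eq (hN : 0 < N) (hS : MeasurableSet S)
    (h : ∀ n < N, IsRieszSpectrum (foldLevel N S n) (Λ n)) {u : ℝ → ℂ}
    (hu : MemLp u 2 unitVol) :
    ∃ g, HasSpectrum g (interleave N Λ) ∧ ∀ᵐ t ∂unitVol, t ∈ S → g t = u t := by
  obtain ⟨H, hH, htarget⟩ := IsRieszSpectrum.exists_fold_components hS h hu (Nat.zero_le N)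
  obtain ⟨g, hg, hgH⟩ := exists_fcoeff_progression hN hH
  refine ⟨g, ⟨hg, fun k hk => ?_⟩, ae_of_ae_foldPt hN ?_⟩
  · obtain ⟨n, hn, l, rfl⟩ := exists_eq_mul_add hN k
    rw [hgH n hn, (htarget n hn (Nat.zero_le n)).1.2 l fun hl => hk ⟨n, hn, l, hl, rfl⟩]
  · have hcomp : ∀ n < N, foldComp N g n =ᵐ[unitVol] H n := fun n hn =>
      ae_eq_of_fcoeff (memLp_foldComp hg n) (hH n) fun k => by
        rw [fcoeff_foldComp hN hg, hgH n hn]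
    filter_upwards [ae_forall_lt hcomp, ae_forall_lt fun n hn => (htarget n hn (Nat.zero_le n)).2]
      with y hgy hy j hj hjS
    rw [← sum_foldComp g y hj,
      Finset.sum_congr rfl fun n hn => by rw [hgy n (Finset.mem_range.1 hn)]]
    have hJ := foldIndices_subset_range N S y
    refine (forall_sum_eq_iff_eq_foldTarget hJ u H y).2 (fun n hn => hy n ?_ hn) j
      (mem_foldIndices.2 ⟨hj, hjS⟩)
    exact hn.trans_le ((Finset.card_le_card hJ).trans_eq (Finset.card_range N))

theorem IsRieszSpectrum.interleave (hN : 0 < N) (hS : MeasurableSet S)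
    (h : ∀ n < N, IsRieszSpectrum (foldLevel N S n) (Λ n)) :
    IsRieszSpectrum S (interleave N Λ) :=
  ⟨fun _ hg h0 => IsRieszSpectrum.interleave_ae_eq_zero hN h hg h0,
    fun _ hu => IsRieszSpectrum.interleave_exists_eq hN hS h hu⟩

end fold

/-! ### Perturbations of the exponential basis and short arcs -/

theorem exists_equiv_of_perturbation {ι 𝕜 X : Type*} [RCLike 𝕜] [NormedAddCommGroup X]
    [NormedSpace 𝕜 X] [CompleteSpace X] {e f : ι → X}
    (he : Dense (Submodule.span 𝕜 (Set.range e) : Set X)) {q : ℝ} (hq0 : 0 ≤ q) (hq1 : q < 1)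
    (h : ∀ (s : Finset ι) (c : ι → 𝕜), ‖∑ i ∈ s, c i • (e i - f i)‖ ≤ q * ‖∑ i ∈ s, c i • e i‖) :
    ∃ V : X ≃L[𝕜] X, ∀ i, V (e i) = f i := by
  let E := Finsupp.linearCombination 𝕜 e
  let D := Finsupp.linearCombination 𝕜 fun i => e i - f i
  have hE : DenseRange E := by
    rw [← Finsupp.range_linearCombination] at he
    exact he
  have hDE : ∀ c, ‖D c‖ ≤ q * ‖E c‖ := fun c => by
    simpa only [D, E, Finsupp.linearCombination_apply, Finsupp.sum] using h c.support c
  let K : X →L[𝕜] X := D.extendOfNorm E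
  have hK : ‖K‖ < 1 := (LinearMap.opNorm_extendOfNorm_le hE hq0 hDE).trans_lt hq1
  have hKe : ∀ i, K (e i) = e i - f i := fun i => by
    simpa [E, D] using LinearMap.extendOfNorm_eq hE ⟨q, hDE⟩ (Finsupp.single i 1)
  refine ⟨ContinuousLinearEquiv.unitsEquiv 𝕜 X (Units.oneSub K hK), fun i => ?_⟩
  calc e i - K (e i) = f i := by rw [hKe, sub_sub_cancel]

theorem norm_toLp_sq {α : Type*} [MeasurableSpace α] {μ : Measure α} {f : α → ℂ}
    (hf : MemLp f 2 μ) : ‖hf.toLp f‖ ^ 2 = ∫ t, ‖f t‖ ^ 2 ∂μ := by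
  have hinner : inner ℂ (hf.toLp f) (hf.toLp f) = ((∫ t, ‖f t‖ ^ 2 ∂μ : ℝ) : ℂ) := by
    rw [L2.inner_def, ← integral_complex_ofReal]
    refine integral_congr_ae ?_
    filter_upwards [hf.coeFn_toLp] with t ht
    rw [ht, inner_self_eq_norm_sq_to_K]
    norm_cast
  rw [inner_self_eq_norm_sq_to_K] at hinner
  exact RCLike.ofReal_injective (K := ℂ) (by rw [RCLike.ofReal_pow]; exact hinner)

theorem sum_smul_toLp {α ι : Type*} [MeasurableSpace α] {μ : Measure α} {s : Finset ι}
    {f : ι → α → ℂ} (hf : ∀ i, MemLp (f i) 2 μ) (c : ι → ℂ)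
    (hsum : MemLp (fun t => ∑ i ∈ s, c i * f i t) 2 μ) :
    ∑ i ∈ s, c i • (hf i).toLp (f i) = hsum.toLp _ := by
  refine Lp.ext ((Lp.coeFn_finsetSum _ _).trans (EventuallyEq.trans ?_ hsum.coeFn_toLp.symm))
  have hterm : ∀ᵐ t ∂μ, ∀ i ∈ s, (c i • (hf i).toLp (f i) : Lp ℂ 2 μ) t = c i * f i t := by
    refine (Finset.eventually_all s).2 fun i _ => ?_
    filter_upwards [Lp.coeFn_smul (c i) ((hf i).toLp (f i)), (hf i).coeFn_toLp] with t hsmul ht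
    rw [hsmul, Pi.smul_apply, ht, smul_eq_mul]
  filter_upwards [hterm] with t ht
  rw [Finset.sum_apply, Finset.sum_congr rfl ht]

theorem sq_integral_le_integral_sq {Ω : Type*} [MeasurableSpace Ω] {μ : Measure Ω}
    [IsProbabilityMeasure μ] {f : Ω → ℝ} (hf : MemLp f 2 μ) :
    (∫ t, f t ∂μ) ^ 2 ≤ ∫ t, f t ^ 2 ∂μ := by
  simpa [ProbabilityTheory.variance_eq_sub hf] using ProbabilityTheory.variance_nonneg f μ

theorem memLp_of_continuous {f : ℝ → ℂ} (hf : Continuous f) : MemLp f 2 unitVol := by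
  obtain ⟨C, hC⟩ := (isCompact_Icc (a := (0 : ℝ)) (b := 1)).exists_bound_of_continuousOn
    hf.continuousOn
  refine MemLp.of_bound hf.aestronglyMeasurable C ?_
  filter_upwards [ae_restrict_mem measurableSet_Ioc] with t ht
  exact hC t (Set.Ioc_subset_Icc_self ht)

theorem memLp_expFun (l : ℝ) : MemLp (expFun l) 2 unitVol :=
  memLp_of_continuous (continuous_expFun l)

theorem expBasis_eq_toLp (k : ℤ) : expBasis k = (memLp_expFun k).toLp _ :=
  Lp.ext ((coeFn_expBasis k).trans (memLp_expFun k).coeFn_toLp.symm)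

theorem norm_sum_smul_expBasis_sq (s : Finset ℤ) (c : ℤ → ℂ) :
    ‖∑ n ∈ s, c n • expBasis n‖ ^ 2 = ∑ n ∈ s, ‖c n‖ ^ 2 := by
  have hinner := expBasis.orthonormal.inner_sum c c s
  rw [inner_self_eq_norm_sq_to_K] at hinner
  simp only [Complex.conj_mul'] at hinner
  exact RCLike.ofReal_injective (K := ℂ) (by
    rw [RCLike.ofReal_pow, hinner]; push_cast; rfl)

theorem integral_norm_sum_expFun_sq (s : Finset ℤ) (c : ℤ → ℂ) :
    ∫ t, ‖∑ n ∈ s, c n * expFun n t‖ ^ 2 ∂unitVol = ∑ n ∈ s, ‖c n‖ ^ 2 := by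
  have hsum : MemLp (fun t => ∑ n ∈ s, c n * expFun n t) 2 unitVol :=
    memLp_of_continuous (by fun_prop)
  simp only [← norm_sum_smul_expBasis_sq, expBasis_eq_toLp,
    sum_smul_toLp (fun n : ℤ => memLp_expFun n) c hsum, norm_toLp_sq]

theorem expFun_sub_one_eq_integral (a t : ℝ) :
    expFun a t - 1 = ∫ r in (0 : ℝ)..t, 2 * Real.pi * Complex.I * a * expFun a r := by
  have hderiv : ∀ r ∈ Set.uIcc 0 t,
      HasDerivAt (expFun a) (2 * Real.pi * Complex.I * a * expFun a r) r := fun r _ => by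
    have h := (((hasDerivAt_id r).ofReal_comp).const_mul (2 * Real.pi * Complex.I * a : ℂ)).cexp
    convert! h using 1
    simp only [expFun, id, Complex.ofReal_one]
    ring
  rw [intervalIntegral.integral_eq_sub_of_hasDerivAt hderiv, expFun_zero_right]
  exact Continuous.intervalIntegrable (by fun_prop) _ _

section perturbation

variable {ι : Type*} (s : Finset ι) (c : ι → ℂ) (l ε : ι → ℝ)

/-- The `r`-derivative of `∑ n ∈ s, c n * expFun (l n) t * expFun (ε n) r`: a path from the
exponential sum with frequencies `l n` to the one with frequencies `l n + ε n`, in which `t` and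
the perturbation parameter `r` are decoupled. -/
noncomputable def perturbDeriv (r t : ℝ) : ℂ :=
  ∑ n ∈ s, c n * (2 * Real.pi * Complex.I * ε n * expFun (ε n) r) * expFun (l n) t

theorem continuous_uncurry_perturbDeriv :
    Continuous (Function.uncurry (perturbDeriv s c l ε)) := by
  simp only [perturbDeriv, Function.uncurry_def]
  fun_prop

theorem sum_mul_expFun_sub_eq_integral (t : ℝ) :
    ∑ n ∈ s, c n * (expFun (l n + ε n) t - expFun (l n) t) =
      ∫ r in (0 : ℝ)..t, perturbDeriv s c l ε r t := by
  unfold perturbDeriv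
  rw [intervalIntegral.integral_finsetSum
    fun n _ => Continuous.intervalIntegrable (by fun_prop) _ _]
  refine Finset.sum_congr rfl fun n _ => ?_
  rw [intervalIntegral.integral_mul_const, intervalIntegral.integral_const_mul,
    ← expFun_sub_one_eq_integral, expFun_add_left]
  ring

theorem norm_sum_mul_expFun_sub_sq_le {t : ℝ} (ht : t ∈ Set.Ioc (0 : ℝ) 1) :
    ‖∑ n ∈ s, c n * (expFun (l n + ε n) t - expFun (l n) t)‖ ^ 2 ≤
      ∫ r, ‖perturbDeriv s c l ε r t‖ ^ 2 ∂unitVol := by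
  have hcont : Continuous fun r => perturbDeriv s c l ε r t := by unfold perturbDeriv; fun_prop
  have hle : ‖∫ r in (0 : ℝ)..t, perturbDeriv s c l ε r t‖ ≤
      ∫ r, ‖perturbDeriv s c l ε r t‖ ∂unitVol := by
    refine (intervalIntegral.norm_integral_le_integral_norm ht.1.le).trans ?_
    rw [intervalIntegral.integral_of_le ht.1.le]
    exact setIntegral_mono_set hcont.norm.integrableOn_Ioc
      (Eventually.of_forall fun _ => norm_nonneg _)
      (Eventually.of_forall (Set.Ioc_subset_Ioc_right ht.2))
  rw [sum_mul_expFun_sub_eq_integral]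
  exact (pow_le_pow_left₀ (norm_nonneg _) hle 2).trans
    (sq_integral_le_integral_sq (memLp_of_continuous hcont).norm)

theorem integrable_norm_perturbDeriv_sq :
    Integrable (Function.uncurry fun t r => ‖perturbDeriv s c l ε r t‖ ^ 2)
      (unitVol.prod unitVol) := by
  have hcont : Continuous (Function.uncurry fun t r => ‖perturbDeriv s c l ε r t‖ ^ 2) :=
    ((continuous_uncurry_perturbDeriv s c l ε).comp continuous_swap).norm.pow 2
  rw [Measure.prod_restrict]
  exact (hcont.continuousOn.integrableOn_compact (isCompact_Icc.prod isCompact_Icc)).mono_set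
    (Set.prod_mono Set.Ioc_subset_Icc_self Set.Ioc_subset_Icc_self)

end perturbation

section integerPerturbation

variable {ε : ℤ → ℝ} {δ : ℝ}

theorem integral_norm_perturbDeriv_sq_le (hδ : ∀ n, |ε n| ≤ δ) (s : Finset ℤ) (c : ℤ → ℂ) (r : ℝ) :
    ∫ t, ‖perturbDeriv s c (↑) ε r t‖ ^ 2 ∂unitVol ≤
      (2 * Real.pi * δ) ^ 2 * ∑ n ∈ s, ‖c n‖ ^ 2 := by
  unfold perturbDeriv
  rw [integral_norm_sum_expFun_sq, Finset.mul_sum]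
  refine Finset.sum_le_sum fun n _ => ?_
  have hnorm : ‖c n * (2 * Real.pi * Complex.I * ε n * expFun (ε n) r)‖ =
      2 * Real.pi * |ε n| * ‖c n‖ := by
    simp [norm_expFun, abs_of_pos Real.pi_pos, mul_comm]
  rw [hnorm, mul_pow]
  have := hδ n
  gcongr

theorem integral_norm_sum_mul_expFun_sub_sq_le (hδ : ∀ n, |ε n| ≤ δ) (s : Finset ℤ)
    (c : ℤ → ℂ) :
    ∫ t, ‖∑ n ∈ s, c n * (expFun (n + ε n) t - expFun n t)‖ ^ 2 ∂unitVol ≤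
      (2 * Real.pi * δ) ^ 2 * ∑ n ∈ s, ‖c n‖ ^ 2 := by
  have hbox := integrable_norm_perturbDeriv_sq s c (fun n : ℤ => (n : ℝ)) ε
  have hint : Integrable (fun t => ‖∑ n ∈ s, c n * (expFun (n + ε n) t - expFun n t)‖ ^ 2)
      unitVol :=
    (memLp_of_continuous (by fun_prop)).integrable_norm_pow (by norm_num)
  calc ∫ t, ‖∑ n ∈ s, c n * (expFun (n + ε n) t - expFun n t)‖ ^ 2 ∂unitVol
      ≤ ∫ t, ∫ r, ‖perturbDeriv s c (↑) ε r t‖ ^ 2 ∂unitVol ∂unitVol := by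
        refine integral_mono_ae hint hbox.integral_prod_left ?_
        filter_upwards [ae_restrict_mem measurableSet_Ioc] with t ht
        exact norm_sum_mul_expFun_sub_sq_le s c _ ε ht
    _ = ∫ r, ∫ t, ‖perturbDeriv s c (↑) ε r t‖ ^ 2 ∂unitVol ∂unitVol :=
        integral_integral_swap hbox
    _ ≤ ∫ _, (2 * Real.pi * δ) ^ 2 * ∑ n ∈ s, ‖c n‖ ^ 2 ∂unitVol :=
        integral_mono hbox.integral_prod_right (integrable_const _)
          (integral_norm_perturbDeriv_sq_le hδ s c)
    _ = (2 * Real.pi * δ) ^ 2 * ∑ n ∈ s, ‖c n‖ ^ 2 := by simp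

theorem exists_equiv_expBasis_eq_expFun_add (hδ : ∀ n, |ε n| ≤ δ) (hδ1 : 2 * Real.pi * δ < 1) :
    ∃ V : Lp ℂ 2 unitVol ≃L[ℂ] Lp ℂ 2 unitVol,
      ∀ n, V (expBasis n) =ᵐ[unitVol] expFun (n + ε n) := by
  have hδ0 : 0 ≤ δ := (abs_nonneg _).trans (hδ 0)
  have hdense := Submodule.dense_iff_topologicalClosure_eq_top.2 expBasis.dense_span
  obtain ⟨V, hV⟩ := exists_equiv_of_perturbation (𝕜 := ℂ) (q := 2 * Real.pi * δ)
    (f := fun n : ℤ => (memLp_expFun (n + ε n)).toLp _) hdense (by positivity) hδ1 fun s c => by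
    have hdiff : ∀ n : ℤ, MemLp (expFun (n + ε n) - expFun n) 2 unitVol :=
      fun n => (memLp_expFun _).sub (memLp_expFun _)
    have hsum : MemLp (fun t => ∑ n ∈ s, c n * (expFun (n + ε n) - expFun n) t) 2 unitVol :=
      memLp_of_continuous (by simp only [Pi.sub_apply]; fun_prop)
    refine le_of_sq_le_sq ?_ (by positivity)
    calc ‖∑ n ∈ s, c n • (expBasis n - (memLp_expFun (n + ε n)).toLp _)‖ ^ 2
        = ‖∑ n ∈ s, c n • (hdiff n).toLp _‖ ^ 2 := by
          rw [← norm_neg, ← Finset.sum_neg_distrib]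
          simp only [← smul_neg, neg_sub, expBasis_eq_toLp,
            MemLp.toLp_sub (memLp_expFun _) (memLp_expFun _)]
      _ ≤ (2 * Real.pi * δ) ^ 2 * ∑ n ∈ s, ‖c n‖ ^ 2 := by
          rw [sum_smul_toLp hdiff c hsum, norm_toLp_sq]
          exact integral_norm_sum_mul_expFun_sub_sq_le hδ s c
      _ = (2 * Real.pi * δ * ‖∑ n ∈ s, c n • expBasis n‖) ^ 2 := by
          rw [mul_pow _ ‖_‖, norm_sum_smul_expBasis_sq]
  exact ⟨V, fun n => by rw [hV]; exact (memLp_expFun _).coeFn_toLp⟩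

end integerPerturbation

section compositionOperator

variable {α β : Type*} [MeasurableSpace α] [MeasurableSpace β] {μ : Measure α} {ν : Measure β}
  {φ : α → β} {c : ENNReal}

/-- Composition with `φ` as an operator on `L²`; the domination of the image measure makes it
bounded. -/
noncomputable def compLp (hφ : Measurable φ) (hc : c ≠ ⊤) (h : μ.map φ ≤ c • ν) :
    Lp ℂ 2 ν →L[ℂ] Lp ℂ 2 μ :=
  LinearMap.mkContinuous
    { toFun := fun g => (memLp_comp_of_map_le hφ hc h (Lp.memLp g)).toLp (g ∘ φ)
      map_add' := fun f g => by
        rw [← MemLp.toLp_add, MemLp.toLp_eq_toLp_iff]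
        exact (quasiMeasurePreserving_of_map_le hφ h).ae_eq_comp (Lp.coeFn_add f g)
      map_smul' := fun a g => by
        rw [RingHom.id_apply, ← MemLp.toLp_const_smul, MemLp.toLp_eq_toLp_iff]
        exact (quasiMeasurePreserving_of_map_le hφ h).ae_eq_comp (Lp.coeFn_smul a g) }
    (c ^ (1 / (2 : ENNReal)).toReal).toReal fun g => by
      rw [LinearMap.coe_mk, AddHom.coe_mk, Lp.norm_toLp, Lp.norm_def, ← ENNReal.toReal_mul,
        ← eLpNorm_map_measure ((Lp.memLp g).of_measure_le_smul hc h).1 hφ.aemeasurable]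
      exact ENNReal.toReal_mono (ENNReal.mul_ne_top
        (ENNReal.rpow_ne_top_of_nonneg (by simp) hc) (Lp.eLpNorm_ne_top g))
        (eLpNorm_le_of_measure_le_smul h)

theorem coeFn_compLp (hφ : Measurable φ) (hc : c ≠ ⊤) (h : μ.map φ ≤ c • ν) (g : Lp ℂ 2 ν) :
    compLp hφ hc h g =ᵐ[μ] g ∘ φ :=
  (memLp_comp_of_map_le hφ hc h (Lp.memLp g)).coeFn_toLp

end compositionOperator

section shortInterval

variable {θ : ℝ}

theorem map_mul_unitVol_le (h0 : 0 < θ) (h1 : θ ≤ 1) :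
    unitVol.map (fun t => θ * t) ≤ ENNReal.ofReal θ⁻¹ • unitVol := by
  simpa using map_affine_unitVol_le (b := 0) h0 fun y hy =>
    ⟨by nlinarith [hy.1], by nlinarith [hy.1, hy.2]⟩

/-- The operator `g ↦ g (θ * ·)`, through which restriction to `Ioc 0 θ` is compared with
bases of `L²` of the whole unit interval. -/
noncomputable def dilation (h0 : 0 < θ) (h1 : θ ≤ 1) : Lp ℂ 2 unitVol →L[ℂ] Lp ℂ 2 unitVol :=
  compLp (by fun_prop) ENNReal.ofReal_ne_top (map_mul_unitVol_le h0 h1)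

theorem dilation_ae_eq (h0 : 0 < θ) (h1 : θ ≤ 1) {f : Lp ℂ 2 unitVol} {g : ℝ → ℂ}
    (hfg : f =ᵐ[unitVol] g) : dilation h0 h1 f =ᵐ[unitVol] fun t => g (θ * t) :=
  (coeFn_compLp _ ENNReal.ofReal_ne_top (map_mul_unitVol_le h0 h1) f).trans
    ((quasiMeasurePreserving_of_map_le (by fun_prop) (map_mul_unitVol_le h0 h1)).ae_eq_comp hfg)

theorem ae_unitVol_mul_iff (h0 : 0 < θ) (h1 : θ ≤ 1) {P : ℝ → Prop} :
    (∀ᵐ t ∂unitVol, P (θ * t)) ↔ ∀ᵐ t ∂unitVol, t ∈ Set.Ioc 0 θ → P t := by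
  have hmem : ∀ t, θ * t ∈ Set.Ioc 0 θ ↔ t ∈ Set.Ioc (0 : ℝ) 1 := fun t => by
    simp [Set.mem_Ioc, h0]
  constructor <;> intro h
  · rw [ae_restrict_iff' measurableSet_Ioc] at h ⊢
    have hscaled := (quasiMeasurePreserving_affine 0 (inv_ne_zero h0.ne')).ae h
    filter_upwards [hscaled] with t ht _ htθ
    have hcancel : θ * (θ⁻¹ * t + 0) = t := by field_simp; ring
    rw [hcancel] at ht
    exact ht ((hmem _).1 (by rwa [hcancel]))
  · have hscaled := (quasiMeasurePreserving_of_map_le (by fun_prop)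
      (map_mul_unitVol_le h0 h1)).ae h
    filter_upwards [hscaled, ae_restrict_mem measurableSet_Ioc] with t ht htI
    exact ht ((hmem t).2 htI)

theorem dilation_synth_eq (h0 : 0 < θ) (h1 : θ ≤ 1) {σ : ℤ → ℤ} (hσ : Function.Injective σ)
    {V : Lp ℂ 2 unitVol ≃L[ℂ] Lp ℂ 2 unitVol}
    (hV : ∀ n, V (expBasis n) =ᵐ[unitVol] expFun (θ * σ n)) (a : lp (fun _ : ℤ => ℂ) 2) :
    dilation h0 h1 (synth expBasis hσ a) = V (expBasis.repr.symm a) := by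
  classical
  have heq : ((dilation h0 h1).comp (synth expBasis hσ).toContinuousLinearMap).comp
      (expBasis.repr : Lp ℂ 2 unitVol →L[ℂ] lp (fun _ : ℤ => ℂ) 2) = V := by
    refine ContinuousLinearMap.ext_on
      (Submodule.dense_iff_topologicalClosure_eq_top.2 expBasis.dense_span) ?_
    rintro _ ⟨n, rfl⟩
    change dilation h0 h1 (synth expBasis hσ (expBasis.repr (expBasis n))) = V (expBasis n)
    rw [expBasis.repr_self, synth_single]
    refine Lp.ext ((dilation_ae_eq h0 h1 (coeFn_expBasis (σ n))).trans (.trans ?_ (hV n).symm))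
    exact Eventually.of_forall fun t => expFun_congr (by ring)
  simpa using congrArg (fun F => F (expBasis.repr.symm a)) heq

theorem isRieszSpectrum_Ioc_range (h0 : 0 < θ) (h1 : θ ≤ 1) {σ : ℤ → ℤ}
    (hσ : Function.Injective σ) {V : Lp ℂ 2 unitVol ≃L[ℂ] Lp ℂ 2 unitVol}
    (hV : ∀ n, V (expBasis n) =ᵐ[unitVol] expFun (θ * σ n)) :
    IsRieszSpectrum (Set.Ioc 0 θ) (Set.range σ) where
  ae_eq_zero g hg hg0 := by
    obtain ⟨a, ha⟩ := hg.exists_synth_ae_eq hσ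
    have hzero : V (expBasis.repr.symm a) = 0 := by
      rw [← dilation_synth_eq h0 h1 hσ hV, Lp.eq_zero_iff_ae_eq_zero]
      exact (dilation_ae_eq h0 h1 ha).trans ((ae_unitVol_mul_iff h0 h1).2 hg0)
    obtain rfl : a = 0 := by simpa using hzero
    rw [map_zero] at ha
    exact ha.symm.trans (Lp.coeFn_zero _ _ _)
  exists_eq u hu := by
    let a := expBasis.repr (V.symm (dilation h0 h1 (hu.toLp u)))
    refine ⟨synth expBasis hσ a, hasSpectrum_synth hσ a, (ae_unitVol_mul_iff h0 h1).1 ?_⟩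
    have heq : dilation h0 h1 (synth expBasis hσ a) = dilation h0 h1 (hu.toLp u) := by
      rw [dilation_synth_eq h0 h1 hσ hV]
      simp [a]
    exact (dilation_ae_eq h0 h1 .rfl).symm.trans (heq ▸ dilation_ae_eq h0 h1 hu.coeFn_toLp)

theorem abs_mul_round_div_sub_le (h0 : 0 < θ) (x : ℝ) : |θ * round (x / θ) - x| ≤ θ / 2 := by
  have hfactor : θ * round (x / θ) - x = θ * -(x / θ - round (x / θ)) := by field_simp; ring
  rw [hfactor, abs_mul, abs_neg, abs_of_pos h0]
  nlinarith [abs_sub_round (x / θ)]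

theorem injective_round_div (h0 : 0 < θ) (h1 : θ < 1) :
    Function.Injective fun n : ℤ => round ((n : ℝ) / θ) := by
  intro m n hmn
  dsimp only at hmn
  have hm := abs_le.1 (abs_mul_round_div_sub_le h0 (m : ℝ))
  have hn := abs_le.1 (abs_mul_round_div_sub_le h0 (n : ℝ))
  rw [hmn] at hm
  have hlt : |((m - n : ℤ) : ℝ)| < 1 := by
    push_cast
    exact abs_lt.2 ⟨by linarith [hm.2, hn.1], by linarith [hm.1, hn.2]⟩
  exact sub_eq_zero.1 (Int.abs_lt_one_iff.1 (by exact_mod_cast hlt))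

/-- Rounding the frequencies `n / θ` to integers perturbs the rescaled frequencies by at most
`θ / 2`. -/
theorem exists_isRieszSpectrum_Ioc (h0 : 0 < θ) (h1 : θ ≤ 1 / 4) :
    ∃ Λ, IsRieszSpectrum (Set.Ioc 0 θ) Λ := by
  obtain ⟨V, hV⟩ := exists_equiv_expBasis_eq_expFun_add
    (fun n : ℤ => abs_mul_round_div_sub_le h0 n) (by nlinarith [Real.pi_lt_four, Real.pi_pos])
  exact ⟨_, isRieszSpectrum_Ioc_range h0 (by linarith)
    (injective_round_div h0 (by linarith)) (V := V) fun n => by simpa using hV n⟩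

end shortInterval

section rotation

/-- The rotation `t ↦ t + a` of the circle, read on the fundamental domain `Ioc 0 1`. -/
noncomputable def unitRotation (a t : ℝ) : ℝ := toIocMod one_pos 0 (t + a)

theorem unitRotation_eq_add_int (a t : ℝ) : ∃ n : ℤ, unitRotation a t = t + a + n :=
  ⟨-toIocDiv one_pos 0 (t + a), by
    rw [unitRotation, ← self_sub_toIocDiv_zsmul, zsmul_one, Int.cast_neg, sub_eq_add_neg]⟩

theorem unitRotation_neg_unitRotation (a : ℝ) {t : ℝ} (ht : t ∈ Set.Ioc (0 : ℝ) 1) :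
    unitRotation (-a) (unitRotation a t) = t := by
  obtain ⟨n, hn⟩ := unitRotation_eq_add_int a t
  have hcancel : t + a + n + -a = t + n • (1 : ℝ) := by rw [zsmul_one]; ring
  rw [unitRotation, hn, hcancel, toIocMod_add_zsmul]
  exact (toIocMod_eq_self one_pos).2 (by rwa [zero_add])

theorem measurePreserving_unitRotation (a : ℝ) :
    MeasurePreserving (unitRotation a) unitVol unitVol :=
  measurePreserving_circle_unitVol.comp ((measurePreserving_add_right AddCircle.haarAddCircle
    (a : AddCircle (1 : ℝ))).comp measurePreserving_unitVol_circle)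

theorem expFun_neg_int_eq_unitRotation (k : ℤ) (a t : ℝ) :
    expFun (-k) t = expFun k a * expFun (-k) (unitRotation a t) := by
  obtain ⟨n, hn⟩ := unitRotation_eq_add_int a t
  have hint : expFun (-k) (n : ℝ) = 1 := by exact_mod_cast expFun_int_int (-k) n
  have hcancel : expFun k a * expFun (-k) a = 1 := by
    rw [← expFun_add_left, add_neg_cancel, expFun_zero_left]
  rw [hn, expFun_add_right, expFun_add_right, hint]
  linear_combination -expFun (-k) t * hcancel

theorem fcoeff_comp_unitRotation {g : ℝ → ℂ} (hg : AEStronglyMeasurable g unitVol) (a : ℝ) (k : ℤ) :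
    fcoeff (g ∘ unitRotation a) k = expFun k a * fcoeff g k := by
  have hchange :
      ∫ t, expFun (-k) (unitRotation a t) * g (unitRotation a t) ∂unitVol = fcoeff g k := by
    have hmap := (measurePreserving_unitRotation a).map_eq
    rw [fcoeff]
    conv_rhs => rw [← hmap]
    rw [integral_map (measurePreserving_unitRotation a).aemeasurable]
    rw [hmap]
    exact (continuous_expFun _).aestronglyMeasurable.mul hg
  rw [← hchange, fcoeff, ← integral_const_mul]
  simp only [Function.comp_apply, ← mul_assoc, ← expFun_neg_int_eq_unitRotation]

theorem HasSpectrum.comp_unitRotation {g : ℝ → ℂ} {Λ : Set ℤ} (hg : HasSpectrum g Λ) (a : ℝ) :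
    HasSpectrum (g ∘ unitRotation a) Λ :=
  ⟨hg.1.comp_measurePreserving (measurePreserving_unitRotation a), fun k hk => by
    rw [fcoeff_comp_unitRotation hg.1.1, hg.2 k hk, mul_zero]⟩

theorem mem_add_int_iff {E : Set ℝ} (hE : Function.Periodic (· ∈ E) (1 : ℝ)) (t : ℝ) (n : ℤ) :
    t + n ∈ E ↔ t ∈ E := by
  simpa using iff_of_eq (hE.int_mul n t)

theorem unitRotation_mem_iff {E : Set ℝ} (hE : Function.Periodic (· ∈ E) (1 : ℝ)) (a t : ℝ) :
    unitRotation a t ∈ E ↔ t + a ∈ E := by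
  obtain ⟨n, hn⟩ := unitRotation_eq_add_int a t
  rw [hn, mem_add_int_iff hE]

theorem IsRieszSpectrum.translate {E : Set ℝ} {Λ : Set ℤ} (h : IsRieszSpectrum E Λ)
    (hE : Function.Periodic (· ∈ E) (1 : ℝ)) (a : ℝ) : IsRieszSpectrum {t | t + a ∈ E} Λ where
  ae_eq_zero g hg hg0 := by
    have hzero := h.ae_eq_zero (g ∘ unitRotation (-a)) (hg.comp_unitRotation _) <| by
      filter_upwards [(measurePreserving_unitRotation (-a)).quasiMeasurePreserving.ae hg0]
        with t ht htE
      obtain ⟨n, hn⟩ := unitRotation_eq_add_int (-a) t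
      refine ht ?_
      have hcancel : t + -a + n + a = t + n := by ring
      change unitRotation (-a) t + a ∈ E
      rwa [hn, hcancel, mem_add_int_iff hE]
    filter_upwards [(measurePreserving_unitRotation a).quasiMeasurePreserving.ae hzero,
      ae_restrict_mem measurableSet_Ioc] with t ht htI
    rwa [Function.comp_apply, unitRotation_neg_unitRotation a htI] at ht
  exists_eq u hu := by
    obtain ⟨g, hg, hgu⟩ := h.exists_eq (u ∘ unitRotation (-a))
      (hu.comp_measurePreserving (measurePreserving_unitRotation _))
    refine ⟨g ∘ unitRotation a, hg.comp_unitRotation a, ?_⟩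
    filter_upwards [(measurePreserving_unitRotation a).quasiMeasurePreserving.ae hgu,
      ae_restrict_mem measurableSet_Ioc] with t ht htI htE
    rw [Function.comp_apply, ht ((unitRotation_mem_iff hE a t).2 htE), Function.comp_apply,
      unitRotation_neg_unitRotation a htI]

theorem ae_unitVol_lt_one : ∀ᵐ t ∂unitVol, t < 1 := by
  filter_upwards [ae_restrict_mem measurableSet_Ioc,
    ae_restrict_of_ae (Measure.ae_ne volume (1 : ℝ))] with t ht hne using lt_of_le_of_ne ht.2 hne

theorem exists_isRieszSpectrum_arc (p : ℝ) {θ : ℝ} (h0 : 0 < θ) (h1 : θ ≤ 1 / 4) :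
    ∃ Λ, IsRieszSpectrum {t | Int.fract (t - p) < θ} Λ := by
  obtain ⟨Λ, hΛ⟩ := exists_isRieszSpectrum_Ioc h0 h1
  have harc : IsRieszSpectrum {t | Int.fract t < θ} Λ := by
    refine hΛ.congr ?_
    filter_upwards [ae_unitVol_lt_one, ae_restrict_mem measurableSet_Ioc,
      ae_restrict_of_ae (Measure.ae_ne volume θ)] with t ht1 ht hne
    rw [Int.fract_eq_self.2 ⟨ht.1.le, ht1⟩, Set.mem_Ioc, hne.le_iff_lt]
    exact and_iff_right ht.1
  exact ⟨Λ, by simpa [← sub_eq_add_neg] using harc.translate (fun t => by simp) (-p)⟩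

end rotation

/-! ### Step functions and unions of arcs -/

section stepFunctions

variable {ι α : Type*} {D : Finset ι} {p : ι → ℝ} {s : ι → ℤ} {c : ℤ}

/-- `G` is constant on each half-open interval `[a, b)` between consecutive points congruent
modulo one to the nodes `p i`, `i ∈ D`; equivalently, `G t` depends only on the integer parts of
the `t - p i`. -/
def FloorDetermined (D : Finset ι) (p : ι → ℝ) (G : ℝ → α) : Prop :=
  ∀ ⦃t t'⦄, (∀ i ∈ D, ⌊t - p i⌋ = ⌊t' - p i⌋) → G t = G t'

/-- The nodes `p i`, `i ∈ D`, are pairwise incongruent modulo one. -/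
def Incongruent (D : Finset ι) (p : ι → ℝ) : Prop :=
  ∀ i ∈ D, ∀ j ∈ D, i ≠ j → ∀ k : ℤ, p i - p j ≠ k

/-- The step function with jump `s i` at the points congruent to `p i` modulo one, `i ∈ D`; the
constant `c` normalizes it. -/
noncomputable def stepFun (D : Finset ι) (p : ι → ℝ) (s : ι → ℤ) (c : ℤ) (t : ℝ) : ℤ :=
  c + ∑ i ∈ D, s i * ⌊t - p i⌋

theorem FloorDetermined.erase [DecidableEq ι] {G : ℝ → α} (h : FloorDetermined D p G) {i j : ι}
    (hi : i ∈ D) (hij : i ≠ j) {k : ℤ} (hk : p i - p j = k) :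
    FloorDetermined (D.erase j) p G := by
  refine fun t t' ht => h fun l hl => ?_
  obtain rfl | hlj := eq_or_ne l j
  · have shift (t : ℝ) : t - p l = t - p i + k := by rw [← hk]; ring
    rw [shift, shift, Int.floor_add_intCast, Int.floor_add_intCast,
      ht i (Finset.mem_erase.2 ⟨hij, hi⟩)]
  · exact ht l (Finset.mem_erase.2 ⟨hlj, hl⟩)

theorem floorDetermined_stepFun : FloorDetermined D p (stepFun D p s c) := fun t t' h => by
  simp only [stepFun]
  rw [Finset.sum_congr rfl fun i hi => by rw [h i hi]]

theorem stepFun_add_int (t : ℝ) (k : ℤ) :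
    stepFun D p s c (t + k) = stepFun D p s c t + k * ∑ i ∈ D, s i := by
  have shift (i : ι) : ⌊t + k - p i⌋ = ⌊t - p i⌋ + k := by
    rw [← Int.floor_add_intCast]; congr 1; ring
  simp only [stepFun, shift, mul_add, Finset.sum_add_distrib, ← Finset.sum_mul]
  ring

theorem periodic_stepFun_iff :
    Function.Periodic (stepFun D p s c) 1 ↔ ∑ i ∈ D, s i = 0 := by
  have step (t : ℝ) := stepFun_add_int (D := D) (p := p) (s := s) (c := c) t 1
  simp only [Int.cast_one, one_mul] at step
  simp [Function.Periodic, step]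

theorem measurable_stepFun : Measurable (stepFun D p s c) := by
  unfold stepFun
  fun_prop

theorem stepFun_erase [DecidableEq ι] {i : ι} (hi : s i = 0) :
    stepFun (D.erase i) p s c = stepFun D p s c := by
  ext t
  rw [stepFun, stepFun, Finset.sum_erase _ (by rw [hi, zero_mul])]

theorem tendsto_sub_const_nhdsLT (a t₀ : ℝ) :
    Tendsto (fun t => t - a) (𝓝[<] t₀) (𝓝[<] (t₀ - a)) :=
  tendsto_nhdsWithin_of_tendsto_nhds_of_eventually_within _
    (((continuous_sub_right a).tendsto t₀).mono_left nhdsWithin_le_nhds)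
    (eventually_mem_nhdsWithin.mono fun _ ht => sub_lt_sub_right ht a)

theorem tendsto_sub_const_nhdsGE (a t₀ : ℝ) :
    Tendsto (fun t => t - a) (𝓝[≥] t₀) (𝓝[≥] (t₀ - a)) :=
  tendsto_nhdsWithin_of_tendsto_nhds_of_eventually_within _
    (((continuous_sub_right a).tendsto t₀).mono_left nhdsWithin_le_nhds)
    (eventually_mem_nhdsWithin.mono fun _ ht => sub_le_sub_right ht a)

theorem eventually_floor_sub_eq_ceil_sub_one (D : Finset ι) (p : ι → ℝ) (t₀ : ℝ) :
    ∀ᶠ t in 𝓝[<] t₀, ∀ i ∈ D, ⌊t - p i⌋ = ⌈t₀ - p i⌉ - 1 :=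
  (Finset.eventually_all D).2 fun i _ => tendsto_pure.1
    ((tendsto_floor_left_pure_ceil_sub_one _).comp (tendsto_sub_const_nhdsLT (p i) t₀))

theorem eventually_floor_sub_eq_floor (D : Finset ι) (p : ι → ℝ) (t₀ : ℝ) :
    ∀ᶠ t in 𝓝[≥] t₀, ∀ i ∈ D, ⌊t - p i⌋ = ⌊t₀ - p i⌋ :=
  (Finset.eventually_all D).2 fun i _ => tendsto_pure.1
    ((tendsto_floor_right_pure_floor _).comp (tendsto_sub_const_nhdsGE (p i) t₀))

theorem ceil_sub_one_eq_floor {x : ℝ} (h : ∀ k : ℤ, x ≠ k) : ⌈x⌉ - 1 = ⌊x⌋ := by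
  rw [(Int.ceil_eq_floor_add_one_iff_notMem x).2 fun ⟨k, hk⟩ => h k hk.symm, add_sub_cancel_right]

namespace FloorDetermined

theorem exists_eventually_eq_left {G : ℝ → α} (h : FloorDetermined D p G) (t₀ : ℝ) :
    ∃ v, ∀ᶠ t in 𝓝[<] t₀, G t = v := by
  have hev := eventually_floor_sub_eq_ceil_sub_one D p t₀
  obtain ⟨l, hl⟩ := hev.exists
  exact ⟨G l, hev.mono fun t ht => h fun i hi => by rw [ht i hi, hl i hi]⟩

theorem eventually_eq_left_of_forall_ne {G : ℝ → α} (h : FloorDetermined D p G) {t₀ : ℝ}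
    (ht₀ : ∀ i ∈ D, ∀ k : ℤ, t₀ ≠ p i + k) : ∀ᶠ t in 𝓝[<] t₀, G t = G t₀ :=
  (eventually_floor_sub_eq_ceil_sub_one D p t₀).mono fun t ht => h fun i hi => by
    rw [ht i hi, ceil_sub_one_eq_floor fun k hk => ht₀ i hi k (by linarith)]

theorem eq_of_eventually_eq_left {G : ℝ → α} (h : FloorDetermined D p G)
    (hleft : ∀ t₀, ∀ᶠ t in 𝓝[<] t₀, G t = G t₀) (t t' : ℝ) : G t = G t' := by
  have hG : IsLocallyConstant G := (IsLocallyConstant.iff_eventually_eq G).2 fun t₀ => by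
    rw [← nhdsLT_sup_nhdsGE, eventually_sup]
    exact ⟨hleft t₀, (eventually_floor_sub_eq_floor D p t₀).mono fun t ht => h ht⟩
  exact hG.apply_eq_of_preconnectedSpace t t'

end FloorDetermined

theorem stepFun_eventually_eq_left (hD : Incongruent D p) (s : ι → ℤ) (c : ℤ) {i : ι}
    (hi : i ∈ D) : ∀ᶠ t in 𝓝[<] (p i), stepFun D p s c t = stepFun D p s c (p i) - s i := by
  filter_upwards [eventually_floor_sub_eq_ceil_sub_one D p (p i)] with t ht
  suffices ∑ j ∈ D, s j * (⌊p i - p j⌋ - ⌊t - p j⌋) = s i by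
    simp only [mul_sub, Finset.sum_sub_distrib] at this
    simp only [stepFun]
    linarith
  rw [Finset.sum_eq_single_of_mem i hi]
  · rw [ht i hi]; simp
  · intro j hj hji
    rw [ht j hj, ceil_sub_one_eq_floor (hD i hi j hj hji.symm), sub_self, mul_zero]

/-- The jumps of `G` at the nodes are those of the step function; the difference then has no jump
at all. -/
theorem FloorDetermined.exists_eq_stepFun {G : ℝ → ℤ} (h : FloorDetermined D p G)
    (hD : Incongruent D p) (hG : Function.Periodic G 1) :
    ∃ s c, G = stepFun D p s c ∧ ∑ i ∈ D, s i = 0 := by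
  choose v hv using h.exists_eventually_eq_left
  let s : ι → ℤ := fun i => G (p i) - v (p i)
  let H : ℝ → ℤ := fun t => G t - stepFun D p s 0 t
  have hH : FloorDetermined D p H := fun t t' ht => by
    simp only [H, h ht, floorDetermined_stepFun ht]
  have hH_add (t : ℝ) (k : ℤ) : H (t + k) = H t - k * ∑ i ∈ D, s i := by
    have hGk : G (t + k) = G t := by simpa using hG.int_mul k t
    simp only [H, hGk, stepFun_add_int]
    ring
  have hH_node (i : ι) (hi : i ∈ D) : ∀ᶠ t in 𝓝[<] (p i), H t = H (p i) := by
    filter_upwards [hv (p i), stepFun_eventually_eq_left hD s 0 hi] with t hGt hst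
    simp only [H, hGt, hst, s]
    ring
  have hH_left (t₀ : ℝ) : ∀ᶠ t in 𝓝[<] t₀, H t = H t₀ := by
    by_cases ht₀ : ∃ i ∈ D, ∃ k : ℤ, t₀ = p i + k
    · obtain ⟨i, hi, k, rfl⟩ := ht₀
      have hshift := tendsto_sub_const_nhdsLT k (p i + k)
      rw [add_sub_cancel_right] at hshift
      filter_upwards [hshift.eventually (hH_node i hi)] with t ht
      rw [hH_add, ← ht, ← hH_add, sub_add_cancel]
    · push Not at ht₀
      exact hH.eventually_eq_left_of_forall_ne ht₀
  have hrep : G = stepFun D p s (H 0) := by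
    ext t
    have := hH.eq_of_eventually_eq_left hH_left t 0
    simp only [H, stepFun] at this ⊢
    linarith
  exact ⟨s, H 0, hrep, periodic_stepFun_iff.1 (hrep ▸ hG)⟩

end stepFunctions

section arcUnions

variable {ι : Type*} {D : Finset ι} {p : ι → ℝ} {s : ι → ℤ} {c : ℤ} {E : Set ℝ} {N : ℕ}

/-- `E` is a one-periodic union of half-open intervals with endpoints congruent modulo one to
nodes `p i`, `i ∈ D`. -/
structure IsArcUnion (D : Finset ι) (p : ι → ℝ) (E : Set ℝ) : Prop where
  periodic : Function.Periodic (· ∈ E) 1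
  floorDetermined : FloorDetermined D p (· ∈ E)

theorem indicator_one_eq_one_iff {t : ℝ} : E.indicator (1 : ℝ → ℤ) t = 1 ↔ t ∈ E := by
  by_cases ht : t ∈ E <;> simp [ht]

theorem measurableSet_of_indicator_eq_stepFun
    (h : E.indicator (1 : ℝ → ℤ) = stepFun D p s c) : MeasurableSet E := by
  have : E = stepFun D p s c ⁻¹' {1} := by
    ext t
    rw [Set.mem_preimage, ← h, Set.mem_singleton_iff, indicator_one_eq_one_iff]
  rw [this]
  exact measurable_stepFun (measurableSet_singleton 1)

theorem isArcUnion_of_indicator_eq_stepFun (h : E.indicator (1 : ℝ → ℤ) = stepFun D p s c)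
    (hs : ∑ i ∈ D, s i = 0) : IsArcUnion D p E where
  periodic t := by
    simp only [← indicator_one_eq_one_iff (E := E), h, periodic_stepFun_iff.2 hs t]
  floorDetermined t t' ht := by
    simp only [← indicator_one_eq_one_iff (E := E), h, floorDetermined_stepFun ht]

namespace IsArcUnion

theorem exists_indicator_eq_stepFun (h : IsArcUnion D p E) (hD : Incongruent D p) :
    ∃ s c, E.indicator (1 : ℝ → ℤ) = stepFun D p s c ∧ ∑ i ∈ D, s i = 0 := by
  classical
  have hcongr {t t' : ℝ} (htt' : (t ∈ E) = (t' ∈ E)) :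
      E.indicator (1 : ℝ → ℤ) t = E.indicator 1 t' := by
    simp only [Set.indicator_apply, Pi.one_apply, htt']
  exact FloorDetermined.exists_eq_stepFun (fun t t' ht => hcongr (h.floorDetermined ht)) hD
    fun t => hcongr (h.periodic t)

theorem erase_of_congruent [DecidableEq ι] (h : IsArcUnion D p E) {i j : ι} (hi : i ∈ D)
    (hij : i ≠ j) {k : ℤ} (hk : p i - p j = k) : IsArcUnion (D.erase j) p E :=
  ⟨h.periodic, h.floorDetermined.erase hi hij hk⟩

theorem eq_univ_or_eq_empty (h : IsArcUnion (∅ : Finset ι) p E) : E = Set.univ ∨ E = ∅ := by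
  have hconst (t : ℝ) : (t ∈ E) = (0 ∈ E) := h.floorDetermined (by simp)
  by_cases h0 : (0 : ℝ) ∈ E
  · exact .inl (Set.eq_univ_of_forall fun t => by rw [hconst t]; exact h0)
  · exact .inr (Set.eq_empty_of_forall_notMem fun t => by rw [hconst t]; exact h0)

end IsArcUnion

theorem isArcUnion_erase_of_eq_zero [DecidableEq ι]
    (h : E.indicator (1 : ℝ → ℤ) = stepFun D p s c) (hs : ∑ i ∈ D, s i = 0) {i : ι}
    (hi : s i = 0) : IsArcUnion (D.erase i) p E :=
  isArcUnion_of_indicator_eq_stepFun (h.trans (stepFun_erase hi).symm)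
    (by rwa [Finset.sum_erase _ hi])

theorem abs_jump_eq_one (h : E.indicator (1 : ℝ → ℤ) = stepFun D p s c)
    (hD : Incongruent D p) {i : ι} (hi : i ∈ D) (hsi : s i ≠ 0) : |s i| = 1 := by
  have hval (t : ℝ) : stepFun D p s c t = 0 ∨ stepFun D p s c t = 1 := by
    rw [← h]
    by_cases ht : t ∈ E <;> simp [ht]
  obtain ⟨t, ht⟩ := (stepFun_eventually_eq_left hD s c hi).exists
  rw [abs_eq zero_le_one]
  have := hval t
  have := hval (p i)
  omega

theorem sum_shift_div {M : Type*} [AddCommGroup M] (hN : 0 < N) (f : ℝ → M) (y : ℝ) :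
    ∑ j ∈ Finset.range N, f ((y + 1 + j) / N) =
      ∑ j ∈ Finset.range N, f ((y + j) / N) + (f (y / N + 1) - f (y / N)) := by
  have hN' : (N : ℝ) ≠ 0 := by exact_mod_cast hN.ne'
  have hlast : (y + N) / N = y / N + 1 := by rw [add_div, div_self hN']
  have hsucc := (Finset.sum_range_succ (fun j : ℕ => f ((y + j) / N)) N).symm.trans
    (Finset.sum_range_succ' _ N)
  rw [hlast, Nat.cast_zero, add_zero] at hsucc
  rw [← add_sub_assoc, hsucc, add_sub_cancel_right]
  refine Finset.sum_congr rfl fun j _ => ?_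
  congr 2
  push_cast
  ring

/-- Hermite's identity: both sides increase by one under `z ↦ z + 1` and vanish on `[0, 1)`. -/
theorem sum_floor_add_div (hN : 0 < N) (z : ℝ) :
    ∑ j ∈ Finset.range N, ⌊(z + j) / N⌋ = ⌊z⌋ := by
  have hN' : (0 : ℝ) < N := by exact_mod_cast hN
  have hper : Function.Periodic
      (fun z : ℝ => ∑ j ∈ Finset.range N, ⌊(z + j) / N⌋ - ⌊z⌋) 1 := fun z => by
    simp only [sum_shift_div hN, Int.floor_add_one]
    ring
  have hfract : ∑ j ∈ Finset.range N, ⌊(Int.fract z + j) / N⌋ = 0 :=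
    Finset.sum_eq_zero fun j hj => by
      have hj' : (j : ℝ) + 1 ≤ N := by exact_mod_cast Finset.mem_range.1 hj
      have := Int.fract_nonneg z
      rw [Int.floor_eq_zero_iff, Set.mem_Ico, div_lt_one hN']
      exact ⟨by positivity, by linarith [Int.fract_lt_one z]⟩
  have heq := hper.int_mul ⌊z⌋ (Int.fract z)
  simp only [mul_one, Int.fract_add_floor, hfract, Int.floor_fract] at heq
  linarith

theorem card_foldIndices {R : Type*} [NonAssocSemiring R] (E : Set ℝ) (y : ℝ) :
    ((foldIndices N E y).card : R) =
      ∑ j ∈ Finset.range N, E.indicator (1 : ℝ → R) ((y + j) / N) := by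
  classical
  simp only [Set.indicator_apply, Pi.one_apply, Finset.sum_boole, foldIndices]

theorem card_foldIndices_eq_stepFun (hN : 0 < N)
    (h : E.indicator (1 : ℝ → ℤ) = stepFun D p s c) (y : ℝ) :
    ((foldIndices N E y).card : ℤ) = stepFun D (fun i => N * p i) s (N * c) y := by
  have hN' : (N : ℝ) ≠ 0 := by exact_mod_cast hN.ne'
  have hshift (i : ι) (j : ℕ) : (y + j) / N - p i = (y - N * p i + j) / N := by field
  simp only [card_foldIndices, h, stepFun, Finset.sum_add_distrib]
  rw [Finset.sum_comm]
  simp only [hshift, ← Finset.mul_sum, sum_floor_add_div hN, Finset.sum_const, Finset.card_range,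
    nsmul_eq_mul]

theorem IsArcUnion.foldLevel (h : IsArcUnion D p E) (hN : 0 < N) (n : ℕ) :
    IsArcUnion D (fun i => N * p i) (foldLevel N E n) where
  periodic y := by
    classical
    have hper : Function.Periodic (E.indicator (1 : ℝ → ℤ)) 1 := fun t => by
      simp only [Set.indicator_apply, Pi.one_apply, h.periodic t]
    have hcard : (foldIndices N E (y + 1)).card = (foldIndices N E y).card := by
      zify
      rw [card_foldIndices, card_foldIndices, sum_shift_div hN, hper, sub_self, add_zero]
    simp only [mem_foldLevel, hcard]
  floorDetermined y y' hy := by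
    have hN' : (N : ℝ) ≠ 0 := by exact_mod_cast hN.ne'
    have hfold : foldIndices N E y = foldIndices N E y' := by
      ext j
      rw [mem_foldIndices, mem_foldIndices]
      refine and_congr_right fun _ => iff_of_eq (h.floorDetermined fun i hi => ?_)
      have hshift (y : ℝ) : (y + j) / N - p i = (y - N * p i + j) / N := by field
      simp only [hshift, Int.floor_div_natCast, Int.floor_add_natCast, hy i hi]
    simp only [mem_foldLevel, hfold]

theorem Incongruent.nat_mul_of_irrational
    (hp : ∀ i ∈ D, ∀ j ∈ D, i ≠ j → Irrational (p i - p j)) (hN : 0 < N) :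
    Incongruent D fun i => N * p i := fun i hi j hj hij k hk =>
  ((hp i hi j hj hij).natCast_mul hN.ne').ne_int k (by rw [mul_sub, hk])

theorem exists_stepFun_eq_apply_node (hs : ∑ i ∈ D, s i = 0) (hD : D.Nonempty) (t : ℝ) :
    ∃ i ∈ D, stepFun D p s c t = stepFun D p s c (p i) := by
  obtain ⟨i, hi, hmin⟩ := D.exists_min_image (fun i => Int.fract (t - p i)) hD
  refine ⟨i, hi, ?_⟩
  have hper : stepFun D p s c (p i + ⌊t - p i⌋) = stepFun D p s c (p i) := by
    rw [stepFun_add_int, hs, mul_zero, add_zero]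
  rw [← hper]
  refine floorDetermined_stepFun fun j hj => ?_
  have hshift : p i + ⌊t - p i⌋ - p j = t - p j - Int.fract (t - p i) := by
    rw [← Int.self_sub_floor]; ring
  have := hmin j hj
  have := Int.fract_nonneg (t - p i)
  have := Int.self_sub_floor (t - p j)
  have := Int.fract_lt_one (t - p j)
  rw [hshift, eq_comm, Int.floor_eq_iff]
  constructor <;> linarith

/-- At a node both functions jump, the first by one, so the first takes the values `n` and `n + 1`
on the two sides; and every value of a step function is taken at a node. -/
theorem indicator_eq_stepFun_of_jumps_ne_zero {A : Set ℝ} {σ : ι → ℤ} {c' n : ℤ}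
    (hD : Incongruent D p) (hne : D.Nonempty) (hs0 : ∑ i ∈ D, s i = 0)
    (hs : ∀ i ∈ D, |s i| = 1) (hA : ∀ t, t ∈ A ↔ n < stepFun D p s c t)
    (hσ : A.indicator (1 : ℝ → ℤ) = stepFun D p σ c') (hσ0 : ∀ i ∈ D, σ i ≠ 0) :
    A.indicator (1 : ℝ → ℤ) = stepFun D p s (c - n) := by
  have hval (t : ℝ) : (n < stepFun D p s c t ∧ A.indicator (1 : ℝ → ℤ) t = 1) ∨
      (stepFun D p s c t ≤ n ∧ A.indicator (1 : ℝ → ℤ) t = 0) := by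
    by_cases ht : t ∈ A
    · exact .inl ⟨(hA t).1 ht, by simp [ht]⟩
    · exact .inr ⟨not_lt.1 fun h => ht ((hA t).2 h), by simp [ht]⟩
  have hnode (i : ι) (hi : i ∈ D) :
      stepFun D p s c (p i) = n ∨ stepFun D p s c (p i) = n + 1 := by
    obtain ⟨t, hst, hσt⟩ := ((stepFun_eventually_eq_left hD s c hi).and
      (stepFun_eventually_eq_left hD σ c' hi)).exists
    rw [← hσ] at hσt
    have := hσ0 i hi
    have := hval t
    have := hval (p i)
    rcases (abs_eq zero_le_one).1 (hs i hi) with hsi | hsi <;> omega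
  ext t
  obtain ⟨i, hi, hti⟩ := exists_stepFun_eq_apply_node (c := c) (p := p) hs0 hne t
  have := hnode i hi
  have hsub : stepFun D p s (c - n) t = stepFun D p s c t - n := by simp only [stepFun]; ring
  have := hval t
  omega

end arcUnions

/-! ### Fourier coefficients of step functions -/

theorem tendsto_average_pow {w : ℂ} (hw : ‖w‖ = 1) (hw1 : w ≠ 1) :
    Tendsto (fun M : ℕ => (M : ℂ)⁻¹ * ∑ n ∈ Finset.range M, w ^ n) atTop (𝓝 0) := by
  have hbound : Tendsto (fun M : ℕ => (M : ℝ)⁻¹ * (2 / ‖w - 1‖)) atTop (𝓝 0) := by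
    simpa using (tendsto_inv_atTop_nhds_zero_nat (𝕜 := ℝ)).mul_const (2 / ‖w - 1‖)
  refine squeeze_zero_norm (fun M => ?_) hbound
  rw [norm_mul, norm_inv, Complex.norm_natCast, geom_sum_eq hw1, norm_div]
  gcongr
  refine (norm_sub_le _ _).trans ?_
  rw [norm_pow, hw]
  norm_num

theorem tendsto_average_mul_conj {z z' : ℂ} (hz : ‖z‖ = 1) (hz' : ‖z'‖ = 1) (hne : z ≠ z') :
    Tendsto (fun M : ℕ => (M : ℂ)⁻¹ * ∑ n ∈ Finset.range M, (z * starRingEnd ℂ z') ^ n) atTop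
      (𝓝 0) := by
  refine tendsto_average_pow (by simp [hz, hz']) fun h => hne ?_
  have hconj : starRingEnd ℂ z' * z' = 1 := by rw [Complex.conj_mul', hz']; simp
  linear_combination z' * h - z * hconj

section average

variable {ι : Type*} {D : Finset ι}

theorem norm_sum_mul_pow_sq (a z : ι → ℂ) (n : ℕ) :
    ((‖∑ i ∈ D, a i * z i ^ n‖ ^ 2 : ℝ) : ℂ) = ∑ i ∈ D, ∑ j ∈ D,
      (a i * starRingEnd ℂ (a j)) * (z i * starRingEnd ℂ (z j)) ^ n := by
  rw [Complex.ofReal_pow, ← Complex.mul_conj', map_sum, Finset.sum_mul_sum]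
  refine Finset.sum_congr rfl fun i _ => Finset.sum_congr rfl fun j _ => ?_
  rw [map_mul, map_pow, mul_pow]
  ring

theorem average_norm_sum_mul_pow_sq (a z : ι → ℂ) (M : ℕ) :
    (((M : ℝ)⁻¹ * ∑ n ∈ Finset.range M, ‖∑ i ∈ D, a i * z i ^ n‖ ^ 2 : ℝ) : ℂ) =
      ∑ i ∈ D, ∑ j ∈ D, (a i * starRingEnd ℂ (a j)) *
        ((M : ℂ)⁻¹ * ∑ n ∈ Finset.range M, (z i * starRingEnd ℂ (z j)) ^ n) := by
  rw [Complex.ofReal_mul, Complex.ofReal_sum]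
  simp only [norm_sum_mul_pow_sq, Complex.ofReal_inv, Complex.ofReal_natCast]
  rw [Finset.sum_comm, Finset.mul_sum]
  refine Finset.sum_congr rfl fun i _ => ?_
  rw [Finset.sum_comm, Finset.mul_sum]
  refine Finset.sum_congr rfl fun j _ => ?_
  rw [← Finset.mul_sum, mul_left_comm]

theorem tendsto_average_norm_sq {z : ι → ℂ} (hz : ∀ i ∈ D, ‖z i‖ = 1)
    (hne : ∀ i ∈ D, ∀ j ∈ D, i ≠ j → z i ≠ z j) (a : ι → ℂ) :
    Tendsto (fun M : ℕ => (M : ℝ)⁻¹ * ∑ n ∈ Finset.range M, ‖∑ i ∈ D, a i * z i ^ n‖ ^ 2)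
      atTop (𝓝 (∑ i ∈ D, ‖a i‖ ^ 2)) := by
  classical
  have hpair (i : ι) (hi : i ∈ D) (j : ι) (hj : j ∈ D) : Tendsto (fun M : ℕ =>
      (a i * starRingEnd ℂ (a j)) *
        ((M : ℂ)⁻¹ * ∑ n ∈ Finset.range M, (z i * starRingEnd ℂ (z j)) ^ n)) atTop
      (𝓝 (if i = j then ((‖a i‖ ^ 2 : ℝ) : ℂ) else 0)) := by
    split_ifs with hij
    · subst hij
      refine tendsto_const_nhds.congr' ?_
      filter_upwards [eventually_ne_atTop 0] with M hM
      simp [Complex.mul_conj', hz i hi, hM]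
    · simpa using (tendsto_average_mul_conj (hz i hi) (hz j hj) (hne i hi j hj hij)).const_mul
        (a i * starRingEnd ℂ (a j))
  have hsum := tendsto_finsetSum D fun i hi => tendsto_finsetSum D fun j hj => hpair i hi j hj
  simp only [← average_norm_sum_mul_pow_sq, Finset.sum_ite_eq] at hsum
  rw [Finset.sum_congr rfl fun i hi => if_pos hi, ← Complex.ofReal_sum] at hsum
  exact (Complex.continuous_re.tendsto _).comp hsum

end average

section jumpSum

variable {ι : Type*} {D : Finset ι} {p : ι → ℝ} {s : ι → ℤ} {c : ℤ} {k : ℤ}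

/-- The exponential sum of the jumps `s i` located at the points `p i`: up to the factor
`(2 * π * I * k)⁻¹`, the `k`-th Fourier coefficient of `stepFun D p s c`. -/
noncomputable def jumpSum (D : Finset ι) (p : ι → ℝ) (s : ι → ℤ) (k : ℤ) : ℂ :=
  ∑ i ∈ D, s i * expFun (-k) (p i)

theorem norm_jumpSum_neg (D : Finset ι) (p : ι → ℝ) (s : ι → ℤ) (k : ℤ) :
    ‖jumpSum D p s (-k)‖ = ‖jumpSum D p s k‖ := by
  rw [← Complex.norm_conj]
  simp only [jumpSum, map_sum, map_mul, conj_expFun, Int.cast_neg, map_intCast, neg_neg]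

theorem expFun_neg_ne_of_irrational {x y : ℝ} (h : Irrational (x - y)) (hk : k ≠ 0) :
    expFun (-k) x ≠ expFun (-k) y := fun heq => by
  have hone : expFun (-k) (x - y) = 1 :=
    mul_right_cancel₀ (expFun_ne_zero (-k) y) <| by
      rw [← expFun_add_right, sub_add_cancel, heq, one_mul]
  obtain ⟨n, hn⟩ := (expFun_eq_one_iff _ _).1 hone
  exact (h.intCast_mul (neg_ne_zero.2 hk)).ne_int n (by rw [← hn, Int.cast_neg])

theorem jumpSum_nat_mul (n : ℕ) : jumpSum D (fun i => ((n + 1 : ℕ) : ℝ) * p i) s k =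
    ∑ i ∈ D, (s i * expFun (-k) (p i)) * expFun (-k) (p i) ^ n := by
  refine Finset.sum_congr rfl fun i _ => ?_
  rw [expFun_pow, mul_assoc, ← expFun_add_left]
  congr 1
  exact expFun_congr (by push_cast; ring)

theorem tendsto_average_jumpSum (hp : ∀ i ∈ D, ∀ j ∈ D, i ≠ j → Irrational (p i - p j))
    (hs : ∀ i ∈ D, |s i| = 1) (hk : k ≠ 0) :
    Tendsto (fun M : ℕ => (M : ℝ)⁻¹ * ∑ n ∈ Finset.range M,
      ‖jumpSum D (fun i => ((n + 1 : ℕ) : ℝ) * p i) s k‖ ^ 2) atTop (𝓝 (D.card : ℝ)) := by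
  have hnorm (i : ι) (hi : i ∈ D) : ‖(s i : ℂ) * expFun (-k) (p i)‖ ^ 2 = 1 := by
    rw [norm_mul, norm_expFun, mul_one, Complex.norm_intCast, ← Int.cast_abs, hs i hi]
    simp
  have h := tendsto_average_norm_sq (z := fun i => expFun (-k) (p i))
    (fun i _ => norm_expFun _ _)
    (fun i hi j hj hij => expFun_neg_ne_of_irrational (hp i hi j hj hij) hk)
    fun i => s i * expFun (-k) (p i)
  rw [Finset.sum_congr rfl hnorm, Finset.sum_const, nsmul_one] at h
  simpa only [jumpSum_nat_mul] using h

/-- On average over `N` the right-hand side is `5 / 4 * D.card ≥ 5`, and `π ^ 2 / 2 < 5`. -/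
theorem exists_large_jumpSum (hp : ∀ i ∈ D, ∀ j ∈ D, i ≠ j → Irrational (p i - p j))
    (hs : ∀ i ∈ D, |s i| = 1) (hD : 4 ≤ D.card) : ∃ N : ℕ, 0 < N ∧
      Real.pi ^ 2 / 2 < ‖jumpSum D (fun i => N * p i) s 1‖ ^ 2 +
        ‖jumpSum D (fun i => N * p i) s 2‖ ^ 2 / 4 := by
  by_contra! hsmall
  have hlim := (tendsto_average_jumpSum hp hs one_ne_zero).add
    ((tendsto_average_jumpSum hp hs two_ne_zero).div_const 4)
  have hle := le_of_tendsto hlim (b := Real.pi ^ 2 / 2) <| by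
    filter_upwards [eventually_gt_atTop 0] with M hM
    have hM' : (0 : ℝ) < M := by exact_mod_cast hM
    rw [mul_div_assoc, ← mul_add, inv_mul_le_iff₀ hM', Finset.sum_div,
      ← Finset.sum_add_distrib]
    simpa using Finset.sum_le_card_nsmul (Finset.range M) _ _ fun n _ =>
      hsmall (n + 1) n.succ_pos
  have hcard : (4 : ℝ) ≤ D.card := by exact_mod_cast hD
  nlinarith [Real.pi_lt_d2, Real.pi_pos]

theorem fcoeff_const (a : ℂ) (hk : k ≠ 0) : fcoeff (fun _ => a) k = 0 := by
  have hbasis : fcoeff (expFun (0 : ℤ)) k = 0 := by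
    rw [← expBasis_repr_toLp (memLp_expFun _), ← expBasis_eq_toLp,
      HilbertBasis.repr_apply_apply, expBasis.orthonormal.inner_eq_zero hk]
  simp only [fcoeff, Int.cast_zero, expFun_zero_left, mul_one] at hbasis
  rw [fcoeff, integral_mul_const, hbasis, zero_mul]

theorem integrable_expFun_mul {g : ℝ → ℂ} (hg : MemLp g 2 unitVol) (l : ℝ) :
    Integrable (fun t => expFun l t * g t) unitVol :=
  (memLp_expFun_mul hg l continuous_id).integrable one_le_two

theorem fcoeff_sub {f g : ℝ → ℂ} (hf : MemLp f 2 unitVol) (hg : MemLp g 2 unitVol) (k : ℤ) :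
    fcoeff (fun t => f t - g t) k = fcoeff f k - fcoeff g k := by
  simp only [fcoeff, mul_sub]
  exact integral_sub (integrable_expFun_mul hf _) (integrable_expFun_mul hg _)

theorem fcoeff_eq_fourierCoeffOn (g : ℝ → ℂ) (k : ℤ) :
    fcoeff g k = fourierCoeffOn zero_lt_one g k := by
  rw [fourierCoeffOn_eq_integral, sub_zero, div_one, one_smul,
    intervalIntegral.integral_of_le zero_le_one, fcoeff, unitVol]
  congr 1 with t
  rw [fourier_coe_apply, expFun, smul_eq_mul]
  congr 2
  push_cast
  ring

theorem fcoeff_id (hk : k ≠ 0) :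
    fcoeff (fun t => (t : ℂ)) k = Complex.I / (2 * Real.pi * k) := by
  have hbernoulli := bernoulliFourierCoeff_eq one_ne_zero k
  rw [bernoulliFourierCoeff, ← fcoeff_eq_fourierCoeffOn] at hbernoulli
  simp only [bernoulliFun_one, Complex.ofReal_sub] at hbernoulli
  rw [fcoeff_sub (memLp_of_continuous Complex.continuous_ofReal) (memLp_const _),
    fcoeff_const _ hk, sub_zero] at hbernoulli
  rw [hbernoulli, Nat.factorial_one, Nat.cast_one, pow_one, ← Complex.I_mul_I]
  field

theorem fcoeff_fract (hk : k ≠ 0) :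
    fcoeff (fun t => ((Int.fract t : ℝ) : ℂ)) k = Complex.I / (2 * Real.pi * k) := by
  rw [← fcoeff_id hk]
  apply fcoeff_congr
  filter_upwards [ae_unitVol_lt_one, ae_restrict_mem measurableSet_Ioc] with t hlt ht
  rw [Int.fract_eq_self.2 ⟨ht.1.le, hlt⟩]

theorem fcoeff_fract_sub (q : ℝ) (hk : k ≠ 0) :
    fcoeff (fun t => ((Int.fract (t - q) : ℝ) : ℂ)) k =
      expFun (-k) q * (Complex.I / (2 * Real.pi * k)) := by
  have hrot : (fun t => ((Int.fract (t - q) : ℝ) : ℂ)) =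
      (fun t => ((Int.fract t : ℝ) : ℂ)) ∘ unitRotation (-q) := by
    ext t
    obtain ⟨n, hn⟩ := unitRotation_eq_add_int (-q) t
    rw [Function.comp_apply, hn, Int.fract_add_intCast, sub_eq_add_neg]
  rw [hrot, fcoeff_comp_unitRotation (by fun_prop), fcoeff_fract hk,
    expFun_congr (show k * -q = -k * q by ring)]

theorem memLp_fract_sub (q : ℝ) : MemLp (fun t => ((Int.fract (t - q) : ℝ) : ℂ)) 2 unitVol :=
  MemLp.of_bound (by fun_prop : Measurable _).aestronglyMeasurable 1 <|
    Eventually.of_forall fun t => by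
      rw [Complex.norm_real, Real.norm_of_nonneg (Int.fract_nonneg _)]
      exact (Int.fract_lt_one _).le

theorem fcoeff_sum_mul {f : ι → ℝ → ℂ} (hf : ∀ i ∈ D, MemLp (f i) 2 unitVol) (a : ι → ℂ)
    (k : ℤ) : fcoeff (fun t => ∑ i ∈ D, a i * f i t) k = ∑ i ∈ D, a i * fcoeff (f i) k := by
  simp only [fcoeff, Finset.mul_sum, mul_left_comm _ (a _)]
  rw [integral_finsetSum _ fun i hi => (integrable_expFun_mul (hf i hi) _).const_mul _]
  simp only [integral_const_mul]

theorem stepFun_eq_sub_sum_fract (hs : ∑ i ∈ D, s i = 0) (t : ℝ) :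
    (stepFun D p s c t : ℂ) =
      c - ∑ i ∈ D, s i * p i - ∑ i ∈ D, s i * ((Int.fract (t - p i) : ℝ) : ℂ) := by
  have hs' : ∑ i ∈ D, (s i : ℂ) = 0 := by exact_mod_cast hs
  have hterm (i : ι) : (s i : ℂ) * ((Int.fract (t - p i) : ℝ) : ℂ) =
      s i * t - s i * p i - s i * ⌊t - p i⌋ := by
    rw [← Int.self_sub_floor]
    push_cast
    ring
  simp only [hterm, Finset.sum_sub_distrib, ← Finset.sum_mul, hs', stepFun]
  push_cast
  ring

theorem fcoeff_stepFun (hs : ∑ i ∈ D, s i = 0) (hk : k ≠ 0) :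
    fcoeff (fun t => (stepFun D p s c t : ℂ)) k =
      -(jumpSum D p s k * (Complex.I / (2 * Real.pi * k))) := by
  simp only [stepFun_eq_sub_sum_fract hs]
  rw [fcoeff_sub (memLp_const _) (memLp_finsetSum _ fun i _ => (memLp_fract_sub _).const_mul _),
    fcoeff_const _ hk, fcoeff_sum_mul fun i _ => memLp_fract_sub _, zero_sub, jumpSum,
    Finset.sum_mul]
  simp only [fcoeff_fract_sub _ hk, mul_assoc]

theorem norm_fcoeff_stepFun_sq (hs : ∑ i ∈ D, s i = 0) (hk : k ≠ 0) :
    ‖fcoeff (fun t => (stepFun D p s c t : ℂ)) k‖ ^ 2 =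
      ‖jumpSum D p s k‖ ^ 2 / (4 * Real.pi ^ 2 * (k : ℝ) ^ 2) := by
  rw [fcoeff_stepFun hs hk]
  simp only [norm_neg, norm_mul, norm_div, Complex.norm_I, Complex.norm_real,
    Complex.norm_intCast, Complex.norm_two, Real.norm_eq_abs, mul_pow, div_pow, sq_abs]
  ring

/-- Bessel's inequality for `A.indicator 1 - 1 / 2`, which has absolute value `1 / 2`. -/
theorem sum_norm_fcoeff_indicator_sq_le {A : Set ℝ} (hA : MeasurableSet A) {K : Finset ℤ}
    (hK : 0 ∉ K) : ∑ k ∈ K, ‖fcoeff (A.indicator 1) k‖ ^ 2 ≤ 1 / 4 := by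
  have hind : MemLp (A.indicator (1 : ℝ → ℂ)) 2 unitVol := (memLp_const (1 : ℂ)).indicator hA
  have hf : MemLp (fun t => A.indicator (1 : ℝ → ℂ) t - 1 / 2) 2 unitVol :=
    hind.sub (memLp_const _)
  have hnorm (t : ℝ) : ‖A.indicator (1 : ℝ → ℂ) t - 1 / 2‖ ^ 2 = 1 / 4 := by
    by_cases ht : t ∈ A <;> simp [ht] <;> norm_num
  have hbessel := expBasis.orthonormal.sum_inner_products_le (s := K) (hf.toLp _)
  simp only [← HilbertBasis.repr_apply_apply, expBasis_repr_toLp, norm_toLp_sq, hnorm,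
    integral_const, probReal_univ, one_smul] at hbessel
  refine (Finset.sum_congr rfl fun k hk => ?_).trans_le hbessel
  rw [fcoeff_sub hind (memLp_const _), fcoeff_const _ (ne_of_mem_of_not_mem hk hK), sub_zero]

theorem jumpSum_le_of_indicator_eq_stepFun {A : Set ℝ}
    (h : A.indicator (1 : ℝ → ℤ) = stepFun D p s c) (hs : ∑ i ∈ D, s i = 0) :
    ‖jumpSum D p s 1‖ ^ 2 + ‖jumpSum D p s 2‖ ^ 2 / 4 ≤ Real.pi ^ 2 / 2 := by
  have hind : A.indicator (1 : ℝ → ℂ) = fun t => (stepFun D p s c t : ℂ) := by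
    ext t
    rw [← h]
    by_cases ht : t ∈ A <;> simp [ht]
  have hK : (0 : ℤ) ∉ ({1, -1, 2, -2} : Finset ℤ) := by decide
  have hle := sum_norm_fcoeff_indicator_sq_le (measurableSet_of_indicator_eq_stepFun h) hK
  rw [hind, Finset.sum_congr rfl fun k hk =>
    norm_fcoeff_stepFun_sq hs (ne_of_mem_of_not_mem hk hK)] at hle
  have hpi : (0 : ℝ) < Real.pi := Real.pi_pos
  rw [Finset.sum_insert (by decide), Finset.sum_insert (by decide),
    Finset.sum_insert (by decide), Finset.sum_singleton, norm_jumpSum_neg, norm_jumpSum_neg] at hle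
  push_cast at hle
  field_simp at hle
  linarith

end jumpSum

/-! ### Induction on the number of endpoints -/

theorem fract_pos_of_irrational {x : ℝ} (hx : Irrational x) : 0 < Int.fract x :=
  Int.fract_pos.2 (hx.ne_int _)

theorem exists_nat_mul_mem_Ioc {y : ℝ} (hy : 0 < y) (hy1 : y ≤ 1) :
    ∃ M : ℕ, 0 < M ∧ (M : ℝ) * y ∈ Set.Ioc (1 - y) 1 := by
  have hfloor := Nat.floor_le (inv_nonneg.2 hy.le)
  have hlt := Nat.lt_floor_add_one y⁻¹
  rw [← one_div] at hfloor hlt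
  rw [le_div_iff₀ hy] at hfloor
  rw [div_lt_iff₀ hy, add_mul, one_mul] at hlt
  exact ⟨⌊1 / y⌋₊, Nat.floor_pos.2 (one_le_one_div hy hy1), by linarith, hfloor⟩

/-- Dirichlet's theorem gives a multiple of `α` close to an integer; if it lies below that integer,
then a further multiple, just exceeding `-1`, lies above one. -/
theorem exists_nat_mul_fract_le {α : ℝ} (hα : Irrational α) :
    ∃ N : ℕ, 0 < N ∧ 0 < Int.fract (N * α) ∧ Int.fract (N * α) ≤ 1 / 4 := by
  suffices ∃ N : ℕ, 0 < N ∧ ∃ k : ℤ, N * α - k ∈ Set.Icc (0 : ℝ) (1 / 4) by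
    obtain ⟨N, hN, k, hk0, hk1⟩ := this
    refine ⟨N, hN, fract_pos_of_irrational (hα.natCast_mul hN.ne'), ?_⟩
    rw [← Int.fract_sub_intCast _ k, Int.fract_eq_self.2 ⟨hk0, by linarith⟩]
    exact hk1
  obtain ⟨K, hK, -, hle⟩ := Real.exists_nat_abs_mul_sub_round_le α (n := 4) (by norm_num)
  obtain ⟨hneg, hpos⟩ := abs_le.1 hle
  push_cast at hneg hpos
  set x : ℝ := K * α - round (K * α) with hx
  obtain h0 | h0 := le_or_gt 0 x
  · exact ⟨K, hK, round (K * α), h0, by linarith⟩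
  · obtain ⟨M, hM, hM0, hM1⟩ := exists_nat_mul_mem_Ioc (neg_pos.2 h0) (by linarith)
    refine ⟨M * K, Nat.mul_pos hM hK, M * round (K * α) - 1, ?_⟩
    have hshift : ((M * K : ℕ) : ℝ) * α - (M * round (K * α) - 1 : ℤ) = 1 - M * -x := by
      rw [hx]
      push_cast
      ring
    rw [hshift]
    constructor <;> linarith

theorem floor_sub_floor_sub {θ : ℝ} (h0 : 0 < θ) (h1 : θ < 1) (v : ℝ) :
    ⌊v⌋ - ⌊v - θ⌋ = if Int.fract v < θ then 1 else 0 := by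
  have := Int.fract_nonneg v
  have := Int.fract_lt_one v
  have := Int.self_sub_floor v
  split_ifs with h
  · rw [show ⌊v - θ⌋ = ⌊v⌋ - 1 by
      rw [Int.floor_eq_iff]; push_cast; constructor <;> linarith, sub_sub_cancel]
  · rw [show ⌊v - θ⌋ = ⌊v⌋ by
      rw [Int.floor_eq_iff]; constructor <;> linarith [not_lt.1 h], sub_self]

theorem floor_sub_sub_floor_sub {q q' : ℝ} (h0 : 0 < Int.fract (q' - q)) (t : ℝ) :
    ⌊t - q⌋ - ⌊t - q'⌋ =
      (if Int.fract (t - q) < Int.fract (q' - q) then 1 else 0) + ⌊q' - q⌋ := by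
  have hq : t - q' = t - q - Int.fract (q' - q) - ⌊q' - q⌋ := by
    rw [← Int.self_sub_floor]
    ring
  rw [hq, Int.floor_sub_intCast, ← floor_sub_floor_sub h0 (Int.fract_lt_one _) (t - q)]
  ring

theorem exists_isRieszSpectrum_two_nodes {q q' : ℝ} (h0 : 0 < Int.fract (q' - q))
    (h1 : Int.fract (q' - q) ≤ 1 / 4) (n : ℤ) :
    ∃ Λ, IsRieszSpectrum {t | n < ⌊t - q⌋ - ⌊t - q'⌋} Λ := by
  simp only [floor_sub_sub_floor_sub h0]
  obtain h | rfl | h := lt_trichotomy n ⌊q' - q⌋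
  · refine ⟨_, isRieszSpectrum_univ <| Eventually.of_forall fun t => ?_⟩
    change n < _
    split_ifs <;> omega
  · obtain ⟨Λ, hΛ⟩ := exists_isRieszSpectrum_arc q h0 h1
    refine ⟨Λ, hΛ.congr <| Eventually.of_forall fun t => ?_⟩
    rw [Set.mem_ofPred_eq, Set.mem_ofPred_eq]
    split_ifs with h <;> simp [h]
  · refine ⟨_, isRieszSpectrum_empty <| Eventually.of_forall fun t => ?_⟩
    change ¬n < _
    split_ifs <;> omega

section induction

variable {ι : Type*} {D : Finset ι} {p : ι → ℝ} {s : ι → ℤ} {c : ℤ} {E : Set ℝ} {N : ℕ}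

theorem exists_isRieszSpectrum_of_foldLevel (hN : 0 < N) (hE : MeasurableSet E)
    (h : ∀ n < N, ∃ Λ, IsRieszSpectrum (foldLevel N E n) Λ) : ∃ Λ, IsRieszSpectrum E Λ := by
  choose! Λ hΛ using h
  exact ⟨_, IsRieszSpectrum.interleave hN hE hΛ⟩

theorem mem_foldLevel_iff_lt_stepFun (hN : 0 < N)
    (h : E.indicator (1 : ℝ → ℤ) = stepFun D p s c) {n : ℕ} {t : ℝ} :
    t ∈ foldLevel N E n ↔ (n : ℤ) < stepFun D (fun i => N * p i) s (N * c) t := by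
  rw [mem_foldLevel, ← card_foldIndices_eq_stepFun hN h, Nat.cast_lt]

/-- If every level set had a jump at every node, then it would be, up to a constant, the folded step
function itself, whose Fourier coefficients at `±1` and `±2` are too large for an indicator. -/
theorem exists_isArcUnion_erase_foldLevel [DecidableEq ι] (h : IsArcUnion D p E)
    (hp : ∀ i ∈ D, ∀ j ∈ D, i ≠ j → Irrational (p i - p j))
    (hE : E.indicator (1 : ℝ → ℤ) = stepFun D p s c) (hs0 : ∑ i ∈ D, s i = 0)
    (hs : ∀ i ∈ D, |s i| = 1) (hD : 4 ≤ D.card) :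
    ∃ N : ℕ, 0 < N ∧ ∀ n : ℕ, ∃ i ∈ D,
      IsArcUnion (D.erase i) (fun i => N * p i) (foldLevel N E n) := by
  obtain ⟨N, hN, hlarge⟩ := exists_large_jumpSum hp hs hD
  have hNp := Incongruent.nat_mul_of_irrational hp hN
  refine ⟨N, hN, fun n => ?_⟩
  obtain ⟨σ, c', hσ, hσ0⟩ := (h.foldLevel hN n).exists_indicator_eq_stepFun hNp
  by_contra! herase
  have hσne (i : ι) (hi : i ∈ D) : σ i ≠ 0 := fun hi0 =>
    herase i hi (isArcUnion_erase_of_eq_zero hσ hσ0 hi0)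
  have hstep := indicator_eq_stepFun_of_jumps_ne_zero hNp (Finset.card_pos.1 (by omega)) hs0 hs
    (fun t => mem_foldLevel_iff_lt_stepFun hN hE) hσ hσne
  exact (jumpSum_le_of_indicator_eq_stepFun hstep hs0).not_gt hlarge

theorem eq_pair_of_sum_eq_zero [DecidableEq ι] (hs0 : ∑ i ∈ D, s i = 0)
    (hs : ∀ i ∈ D, |s i| = 1) (hne : D.Nonempty) (hD : D.card < 4) :
    ∃ i j, i ≠ j ∧ D = {i, j} ∧ s i = 1 ∧ s j = -1 := by
  have hcard := hne.card_pos
  simp only [abs_eq zero_le_one] at hs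
  obtain h | h | h : D.card = 1 ∨ D.card = 2 ∨ D.card = 3 := by omega
  · obtain ⟨i, rfl⟩ := Finset.card_eq_one.1 h
    simp only [Finset.mem_singleton, forall_eq, Finset.sum_singleton] at hs hs0
    omega
  · obtain ⟨i, j, hij, rfl⟩ := Finset.card_eq_two.1 h
    simp only [Finset.sum_pair hij, Finset.mem_insert, Finset.mem_singleton,
      forall_eq_or_imp, forall_eq] at hs hs0
    obtain hi | hi := hs.1
    · exact ⟨i, j, hij, rfl, hi, by omega⟩
    · exact ⟨j, i, hij.symm, Finset.pair_comm i j, by omega, hi⟩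
  · obtain ⟨i, j, l, hij, hil, hjl, rfl⟩ := Finset.card_eq_three.1 h
    rw [Finset.sum_insert (by simp [hij, hil]), Finset.sum_pair hjl] at hs0
    simp only [Finset.mem_insert, Finset.mem_singleton, forall_eq_or_imp, forall_eq] at hs
    omega

theorem IsArcUnion.exists_isRieszSpectrum_of_card_lt_four (h : IsArcUnion D p E)
    (hp : ∀ i ∈ D, ∀ j ∈ D, i ≠ j → Irrational (p i - p j))
    (hE : E.indicator (1 : ℝ → ℤ) = stepFun D p s c) (hs0 : ∑ i ∈ D, s i = 0)
    (hs : ∀ i ∈ D, |s i| = 1) (hD : D.card < 4) : ∃ Λ, IsRieszSpectrum E Λ := by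
  classical
  obtain rfl | hne := D.eq_empty_or_nonempty
  · obtain rfl | rfl := h.eq_univ_or_eq_empty
    · exact ⟨_, isRieszSpectrum_univ (Eventually.of_forall Set.mem_univ)⟩
    · exact ⟨_, isRieszSpectrum_empty (Eventually.of_forall Set.notMem_empty)⟩
  obtain ⟨i, j, hij, rfl, hi, hj⟩ := eq_pair_of_sum_eq_zero hs0 hs hne hD
  obtain ⟨N, hN, hpos, hle⟩ :=
    exists_nat_mul_fract_le (hp j (by simp) i (by simp) hij.symm)
  rw [mul_sub] at hpos hle
  refine exists_isRieszSpectrum_of_foldLevel hN (measurableSet_of_indicator_eq_stepFun hE)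
    fun n _ => ?_
  obtain ⟨Λ, hΛ⟩ := exists_isRieszSpectrum_two_nodes hpos hle (n - N * c)
  refine ⟨Λ, hΛ.congr <| Eventually.of_forall fun t => ?_⟩
  rw [mem_foldLevel_iff_lt_stepFun hN hE, stepFun, Finset.sum_pair hij, hi, hj]
  change (n : ℤ) - N * c < _ ↔ _
  omega

theorem isArcUnion_erase_foldLevel_den [DecidableEq ι] (h : IsArcUnion D p E) {i j : ι}
    (hi : i ∈ D) (hij : i ≠ j) {r : ℚ} (hr : (r : ℝ) = p i - p j) (n : ℕ) :
    IsArcUnion (D.erase j) (fun i => r.den * p i) (foldLevel r.den E n) := by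
  refine (h.foldLevel r.den_pos n).erase_of_congruent hi hij (k := r.num) ?_
  rw [← mul_sub, ← hr]
  exact_mod_cast r.den_mul_eq_num

/-- Induction on the number of nodes: a node is lost by merging it with a congruent one, when it is
not a jump, or by passing to the level sets of a suitable fold. -/
theorem IsArcUnion.exists_isRieszSpectrum (h : IsArcUnion D p E) : ∃ Λ, IsRieszSpectrum E Λ := by
  classical
  induction hd : D.card using Nat.strong_induction_on generalizing D p E with
  | _ d ih =>
  have ih_erase {p' : ι → ℝ} {E' : Set ℝ} {i : ι} (hi : i ∈ D)
      (h' : IsArcUnion (D.erase i) p' E') : ∃ Λ, IsRieszSpectrum E' Λ :=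
    ih _ (hd ▸ Finset.card_erase_lt_of_mem hi) h' rfl
  by_cases hD : Incongruent D p
  swap
  · simp only [Incongruent, not_forall, not_not] at hD
    obtain ⟨i, hi, j, hj, hij, k, hk⟩ := hD
    exact ih_erase hj (h.erase_of_congruent hi hij hk)
  obtain ⟨s, c, hE, hs0⟩ := h.exists_indicator_eq_stepFun hD
  by_cases hjump : ∃ i ∈ D, s i = 0
  · obtain ⟨i, hi, hsi⟩ := hjump
    exact ih_erase hi (isArcUnion_erase_of_eq_zero hE hs0 hsi)
  push Not at hjump
  have hs (i : ι) (hi : i ∈ D) : |s i| = 1 := abs_jump_eq_one hE hD hi (hjump i hi)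
  have hmeas := measurableSet_of_indicator_eq_stepFun hE
  by_cases hirr : ∀ i ∈ D, ∀ j ∈ D, i ≠ j → Irrational (p i - p j)
  swap
  · simp only [not_forall, Irrational, not_not] at hirr
    obtain ⟨i, hi, j, hj, hij, r, hr⟩ := hirr
    exact exists_isRieszSpectrum_of_foldLevel r.den_pos hmeas fun n _ =>
      ih_erase hj (isArcUnion_erase_foldLevel_den h hi hij hr n)
  obtain hcard | hcard := lt_or_ge D.card 4
  · exact h.exists_isRieszSpectrum_of_card_lt_four hirr hE hs0 hs hcard
  · obtain ⟨N, hN, herase⟩ := exists_isArcUnion_erase_foldLevel h hirr hE hs0 hs hcard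
    refine exists_isRieszSpectrum_of_foldLevel hN hmeas fun n _ => ?_
    obtain ⟨i, hi, hn⟩ := herase n
    exact ih_erase hi hn

end induction

/-! ### Number of sheets over a finite union of intervals -/

section sheetCount

variable {N : ℕ} {S : Set ℝ} {y y' : ℝ}

theorem card_foldIndices_le (N : ℕ) (S : Set ℝ) (y : ℝ) : (foldIndices N S y).card ≤ N :=
  (Finset.card_le_card (foldIndices_subset_range N S y)).trans_eq (Finset.card_range N)

theorem eq_of_foldPt_mem_of_foldPt_notMem {I : Set ℝ} (hI : I.OrdConnected) (hy : |y - y'| ≤ 1)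
    {j l : ℕ} (hj : (y + j) / N ∈ I) (hj' : (y' + j) / N ∉ I) (hl : (y + l) / N ∈ I)
    (hl' : (y' + l) / N ∉ I) : j = l := by
  wlog hjl : j < l generalizing j l
  · obtain hlj | rfl := (not_lt.1 hjl).lt_or_eq
    · exact (this hl hl' hj hj' hlj).symm
    · rfl
  have hjl' : (j : ℝ) + 1 ≤ l := by exact_mod_cast hjl
  obtain ⟨hlow, hupp⟩ := abs_le.1 hy
  obtain h | h := le_total y y'
  · exact absurd (hI.out hj hl ⟨by gcongr, by gcongr ?_ / _; linarith⟩) hj'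
  · exact absurd (hI.out hj hl ⟨by gcongr ?_ / _; linarith, by gcongr⟩) hl'

theorem card_sdiff_foldIndices_iUnion_le {κ : Type*} [Fintype κ] {I : κ → Set ℝ}
    (hI : ∀ i, (I i).OrdConnected) (hy : |y - y'| ≤ 1) :
    (foldIndices N (⋃ i, I i) y \ foldIndices N (⋃ i, I i) y').card ≤ Fintype.card κ := by
  have hmem {j : ℕ} (hj : j ∈ foldIndices N (⋃ i, I i) y \ foldIndices N (⋃ i, I i) y') :
      (∃ i, (y + j) / N ∈ I i) ∧ ∀ i, (y' + j) / N ∉ I i := by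
    simp only [Finset.mem_sdiff, mem_foldIndices, Set.mem_iUnion, not_and, not_exists] at hj
    exact ⟨hj.1.2, hj.2 hj.1.1⟩
  refine Finset.card_le_card_of_forall_subsingleton (fun (j : ℕ) i => (y + j) / N ∈ I i)
    (fun j hj => ?_) fun i _ j hj l hl => ?_
  · obtain ⟨i, hi⟩ := (hmem hj).1
    exact ⟨i, Finset.mem_univ i, hi⟩
  · exact eq_of_foldPt_mem_of_foldPt_notMem (hI i) hy hj.2 ((hmem hj.1).2 i) hl.2
      ((hmem hl.1).2 i)

theorem card_foldIndices_iUnion_le_add {κ : Type*} [Fintype κ] {I : κ → Set ℝ}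
    (hI : ∀ i, (I i).OrdConnected) (hy : y ∈ Set.Ioc (0 : ℝ) 1) (hy' : y' ∈ Set.Ioc (0 : ℝ) 1) :
    (foldIndices N (⋃ i, I i) y).card ≤ (foldIndices N (⋃ i, I i) y').card + Fintype.card κ := by
  have hdist : |y - y'| ≤ 1 := abs_le.2 ⟨by linarith [hy.1, hy'.2], by linarith [hy.2, hy'.1]⟩
  have hsdiff := card_sdiff_foldIndices_iUnion_le (N := N) hI hdist
  have hle := Finset.card_le_card_sdiff_add_card (s := foldIndices N (⋃ i, I i) y)
    (t := foldIndices N (⋃ i, I i) y')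
  omega

theorem integrable_indicator_one_unitVol (hS : MeasurableSet S) :
    Integrable (S.indicator (1 : ℝ → ℝ)) unitVol :=
  (integrable_const (1 : ℝ)).indicator hS

theorem integrable_indicator_one_foldPt (hS : MeasurableSet S) {j : ℕ} (hj : j < N) :
    Integrable (fun y : ℝ => S.indicator (1 : ℝ → ℝ) ((y + j) / N)) unitVol :=
  memLp_one_iff_integrable.1 <| memLp_comp_foldPt hj <|
    memLp_one_iff_integrable.2 (integrable_indicator_one_unitVol hS)

theorem integrable_card_foldIndices (N : ℕ) (hS : MeasurableSet S) :
    Integrable (fun y => ((foldIndices N S y).card : ℝ)) unitVol := by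
  simp only [card_foldIndices]
  exact integrable_finsetSum _ fun j hj =>
    integrable_indicator_one_foldPt hS (Finset.mem_range.1 hj)

theorem integral_card_foldIndices (hN : 0 < N) (hS : MeasurableSet S) :
    ∫ y, ((foldIndices N S y).card : ℝ) ∂unitVol = N * unitVol.real S := by
  have hN' : (N : ℝ) ≠ 0 := by exact_mod_cast hN.ne'
  simp only [card_foldIndices]
  rw [← integral_indicator_one hS,
    integral_unitVol_foldPt hN (integrable_indicator_one_unitVol hS),
    integral_finsetSum _ fun j hj => integrable_indicator_one_foldPt hS (Finset.mem_range.1 hj),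
    ← Finset.smul_sum, smul_eq_mul, mul_inv_cancel_left₀ hN']

theorem exists_le_card_foldIndices (hN : 0 < N) (hS : MeasurableSet S) {m : ℕ}
    (hm : m ≤ N * unitVol.real S) : ∃ y ∈ Set.Ioc (0 : ℝ) 1, m ≤ (foldIndices N S y).card := by
  obtain ⟨y, hy, hle⟩ := exists_notMem_null_integral_le (integrable_card_foldIndices N hS)
    (show unitVol (Set.Ioc (0 : ℝ) 1)ᶜ = 0 by simp)
  rw [integral_card_foldIndices hN hS] at hle
  exact ⟨y, not_not.1 hy, by exact_mod_cast hm.trans hle⟩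

theorem exists_card_foldIndices_le (hN : 0 < N) (hS : MeasurableSet S) {m : ℕ}
    (hm : N * unitVol.real S < m + 1) :
    ∃ y ∈ Set.Ioc (0 : ℝ) 1, (foldIndices N S y).card ≤ m := by
  obtain ⟨y, hy, hle⟩ := exists_notMem_null_le_integral (integrable_card_foldIndices N hS)
    (show unitVol (Set.Ioc (0 : ℝ) 1)ᶜ = 0 by simp)
  rw [integral_card_foldIndices hN hS] at hle
  exact ⟨y, not_not.1 hy, Nat.lt_succ_iff.1 (by exact_mod_cast hle.trans_lt hm)⟩

end sheetCount

section finiteUnions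

variable {κ : Type*} {I : κ → Set ℝ} {N : ℕ} {S E : Set ℝ}

theorem ordConnected_ae_eq_Ico {J : Set ℝ} (hJ : J.OrdConnected) (hbdd : Bornology.IsBounded J) :
    J =ᵐ[volume] Set.Ico (sInf J) (sSup J) := by
  obtain rfl | hne := J.eq_empty_or_nonempty
  · simp
  have hconn : IsConnected J := ⟨hne, hJ.isPreconnected⟩
  have hIoo := hconn.Ioo_csInf_csSup_subset hbdd.bddBelow hbdd.bddAbove
  have hIcc := subset_Icc_csInf_csSup hbdd.bddBelow hbdd.bddAbove
  exact (hIcc.eventuallyLE.trans Ico_ae_eq_Icc.symm.le).antisymm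
    (Ioo_ae_eq_Ico.symm.le.trans hIoo.eventuallyLE)

theorem le_fract_iff_floor_le_floor_sub (a t : ℝ) : a ≤ Int.fract t ↔ ⌊t⌋ ≤ ⌊t - a⌋ := by
  rw [Int.le_floor, Int.fract, le_sub_comm]

theorem exists_isArcUnion_ae_iff_mem_iUnion [Finite κ] (hI : ∀ i, (I i).OrdConnected)
    (hbdd : ∀ i, Bornology.IsBounded (I i)) : ∃ (D : Finset ℝ) (E : Set ℝ),
      IsArcUnion D id E ∧ ∀ᵐ t ∂unitVol, t ∈ E ↔ t ∈ ⋃ i, I i := by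
  classical
  have := Fintype.ofFinite κ
  refine ⟨{0} ∪ (Finset.univ.image (fun i => sInf (I i)) ∪ Finset.univ.image fun i => sSup (I i)),
    {t | ∃ i, Int.fract t ∈ Set.Ico (sInf (I i)) (sSup (I i))}, ⟨fun t => ?_, fun t t' h => ?_⟩, ?_⟩
  · simp only [Set.mem_ofPred_eq, Int.fract_add_one]
  · have h0 : ⌊t⌋ = ⌊t'⌋ := by simpa using h 0 (by simp)
    have hinf (i : κ) : ⌊t - sInf (I i)⌋ = ⌊t' - sInf (I i)⌋ := h (sInf (I i)) (by simp)
    have hsup (i : κ) : ⌊t - sSup (I i)⌋ = ⌊t' - sSup (I i)⌋ := h (sSup (I i)) (by simp)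
    simp only [Set.mem_ofPred_eq, Set.mem_Ico, ← not_le (b := Int.fract _),
      le_fract_iff_floor_le_floor_sub, h0, hinf, hsup]
  · have hIco : ∀ᵐ t ∂unitVol, ∀ i, t ∈ I i ↔ t ∈ Set.Ico (sInf (I i)) (sSup (I i)) :=
      ae_restrict_of_ae <| ae_all_iff.2 fun i =>
        (ordConnected_ae_eq_Ico (hI i) (hbdd i)).mem_iff
    filter_upwards [hIco, ae_unitVol_lt_one, ae_restrict_mem measurableSet_Ioc] with t ht ht1 ht0
    simp only [Set.mem_iUnion, ht, Int.fract_eq_self.2 ⟨ht0.1.le, ht1⟩]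

theorem ae_mem_foldLevel_iff (h : ∀ᵐ t ∂unitVol, t ∈ E ↔ t ∈ S) (n : ℕ) :
    ∀ᵐ y ∂unitVol, y ∈ foldLevel N E n ↔ y ∈ foldLevel N S n := by
  filter_upwards [ae_foldPt (N := N) h] with y hy
  have hfold : foldIndices N E y = foldIndices N S y := by
    ext j
    rw [mem_foldIndices, mem_foldIndices]
    exact and_congr_right (hy j)
  rw [mem_foldLevel, mem_foldLevel, hfold]

theorem exists_isRieszSpectrum_foldLevel_iUnion [Finite κ] (hN : 0 < N)
    (hI : ∀ i, (I i).OrdConnected) (hbdd : ∀ i, Bornology.IsBounded (I i)) (n : ℕ) :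
    ∃ Λ, IsRieszSpectrum (foldLevel N (⋃ i, I i) n) Λ := by
  obtain ⟨D, E, hE, hae⟩ := exists_isArcUnion_ae_iff_mem_iUnion hI hbdd
  obtain ⟨Λ, hΛ⟩ := (hE.foldLevel hN n).exists_isRieszSpectrum
  exact ⟨Λ, hΛ.congr (ae_mem_foldLevel_iff hae n)⟩

theorem exists_isRieszSpectrum_foldLevel_of_card_bounds {a b n : ℕ}
    (h : ∃ Λ, IsRieszSpectrum (foldLevel N S n) Λ)
    (hcard : ∀ᵐ y ∂unitVol, (foldIndices N S y).card ∈ Set.Icc a b) :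
    ∃ Λ, IsRieszSpectrum (foldLevel N S n) Λ ∧ (n < a → Λ = Set.univ) ∧ (b ≤ n → Λ = ∅) := by
  obtain ⟨y, hay, hyb⟩ := hcard.exists
  by_cases hna : n < a
  · exact ⟨_, isRieszSpectrum_univ (hcard.mono fun y hy => hna.trans_le hy.1), fun _ => rfl,
      fun hbn => by omega⟩
  by_cases hbn : b ≤ n
  · exact ⟨_, isRieszSpectrum_empty (hcard.mono fun y hy => (hy.2.trans hbn).not_gt),
      fun h => absurd h hna, fun _ => rfl⟩
  obtain ⟨Λ, hΛ⟩ := h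
  exact ⟨Λ, hΛ, fun h => absurd h hna, fun h => absurd h hbn⟩

theorem restrict_eq_unitVol_restrict (hS : S ⊆ Set.Icc 0 1) (hmeas : MeasurableSet S) :
    volume.restrict S = unitVol.restrict S := by
  have hae : (S ∩ Set.Ioc 0 1 : Set ℝ) =ᵐ[volume] (S ∩ Set.Icc 0 1 : Set ℝ) :=
    ae_eq_set_inter .rfl Ioc_ae_eq_Icc
  rw [Measure.restrict_restrict hmeas, Measure.restrict_congr_set hae, Set.inter_eq_left.2 hS]

theorem unitVol_real_eq (hS : S ⊆ Set.Icc 0 1) (hmeas : MeasurableSet S) :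
    unitVol.real S = volume.real S := by
  rw [← measureReal_restrict_apply_self, ← restrict_eq_unitVol_restrict hS hmeas,
    measureReal_restrict_apply_self]

theorem progression_subset_image_interleave {Λ : ℕ → Set ℤ} {n : ℕ} (hn : n < N)
    (hΛ : Λ n = Set.univ) :
    progression N n ⊆ (fun k : ℤ => (k : ℝ)) '' interleave N Λ := by
  rintro _ ⟨k, rfl⟩
  exact ⟨N * k + n, ⟨n, hn, k, hΛ ▸ Set.mem_univ k, rfl⟩, by push_cast; rfl⟩

theorem image_interleave_subset_iUnion_progression {Λ : ℕ → Set ℤ} {b : ℕ}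
    (hΛ : ∀ n, b ≤ n → Λ n = ∅) : (fun k : ℤ => (k : ℝ)) '' interleave N Λ ⊆
      ⋃ j ∈ Set.Ico (0 : ℤ) b, progression N j := by
  rintro _ ⟨_, ⟨n, -, l, hl, rfl⟩, rfl⟩
  have hn : n < b := not_le.1 fun hbn => by simp [hΛ n hbn] at hl
  exact Set.mem_biUnion (x := (n : ℤ)) ⟨by omega, by omega⟩ ⟨l, by push_cast; rfl⟩

theorem mainTheorem6_general [Fintype κ] (N m : ℕ) (hN : 0 < N)
    (hI : ∀ i, (I i).OrdConnected) (hS : ⋃ i, I i ⊆ Set.Icc 0 1)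
    (hm₁ : (m : ℝ) / N ≤ volume.real (⋃ i, I i))
    (hm₂ : volume.real (⋃ i, I i) < ((m : ℝ) + 1) / N) :
    ∃ Λ : Set ℝ, Λ ⊆ Set.range (Int.cast : ℤ → ℝ) ∧ IsExpRieszBasis (⋃ i, I i) Λ ∧
      (⋃ j ∈ Set.Ico (0 : ℤ) (m - Fintype.card κ), progression N j) ⊆ Λ ∧
      Λ ⊆ ⋃ j ∈ Set.Ico (0 : ℤ) (m + Fintype.card κ), progression N j := by
  have hN' : (0 : ℝ) < N := by exact_mod_cast hN
  have hmeas : MeasurableSet (⋃ i, I i) := .iUnion fun i => (hI i).measurableSet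
  rw [← unitVol_real_eq hS hmeas, div_le_iff₀' hN'] at hm₁
  rw [← unitVol_real_eq hS hmeas, lt_div_iff₀' hN'] at hm₂
  obtain ⟨y₁, hy₁, hle₁⟩ := exists_le_card_foldIndices hN hmeas hm₁
  obtain ⟨y₂, hy₂, hle₂⟩ := exists_card_foldIndices_le hN hmeas hm₂
  have hcard : ∀ᵐ y ∂unitVol, (foldIndices N (⋃ i, I i) y).card ∈
      Set.Icc (m - Fintype.card κ) (m + Fintype.card κ) := by
    filter_upwards [ae_restrict_mem measurableSet_Ioc] with y hy
    have := card_foldIndices_iUnion_le_add (N := N) hI hy₁ hy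
    have := card_foldIndices_iUnion_le_add (N := N) hI hy hy₂
    exact ⟨by omega, by omega⟩
  have hbdd (i : κ) := (Metric.isBounded_Icc 0 1).subset ((Set.subset_iUnion I i).trans hS)
  choose Λ hΛ hfull hempty using fun n => exists_isRieszSpectrum_foldLevel_of_card_bounds
    (exists_isRieszSpectrum_foldLevel_iUnion hN hI hbdd n) hcard
  refine ⟨(fun k : ℤ => (k : ℝ)) '' interleave N Λ, Set.image_subset_range _ _,
    (IsRieszSpectrum.interleave hN hmeas fun n _ => hΛ n).isExpRieszBasis hmeas
      (restrict_eq_unitVol_restrict hS hmeas), Set.iUnion₂_subset fun j hj => ?_, ?_⟩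
  · obtain ⟨n, rfl⟩ := Int.eq_ofNat_of_zero_le hj.1
    have := hle₁.trans (card_foldIndices_le N _ y₁)
    have := hj.2
    exact progression_subset_image_interleave (by omega) (hfull n (by omega))
  · exact_mod_cast image_interleave_subset_iUnion_progression hempty

end finiteUnions

theorem mainTheorem6 (L N m : ℕ) (hN : 0 < N) (S : Set ℝ) (I : Fin L → Set ℝ)
    (hI : ∀ i, (I i).OrdConnected) (hSI : S = ⋃ i, I i) (hS : S ⊆ Set.Icc 0 1)
    (hm₁ : (m : ℝ) / N ≤ volume.real S) (hm₂ : volume.real S < ((m : ℝ) + 1) / N) :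
    ∃ Λ : Set ℝ, Λ ⊆ Set.range (Int.cast : ℤ → ℝ) ∧ IsExpRieszBasis S Λ ∧
      (⋃ j ∈ Set.Icc (0 : ℤ) ((m : ℤ) - 2 * L - 1), progression N j) ⊆ Λ ∧
      Λ ⊆ ⋃ j ∈ Set.Icc (0 : ℤ) ((m : ℤ) + 2 * L), progression N j := by
  subst hSI
  obtain ⟨Λ, hint, hbasis, hsub, hsup⟩ := mainTheorem6_general N m hN hI hS hm₁ hm₂
  rw [Fintype.card_fin] at hsub hsup
  have hlow : Set.Icc (0 : ℤ) (m - 2 * L - 1) ⊆ Set.Ico 0 (m - L) := fun j hj => by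
    simp only [Set.mem_Icc, Set.mem_Ico] at hj ⊢; omega
  have hupp : Set.Ico (0 : ℤ) (m + L) ⊆ Set.Icc 0 (m + 2 * L) := fun j hj => by
    simp only [Set.mem_Icc, Set.mem_Ico] at hj ⊢; omega
  exact ⟨Λ, hint, hbasis, (Set.biUnion_subset_biUnion_left hlow).trans hsub,
    hsup.trans (Set.biUnion_subset_biUnion_left hupp)⟩
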